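/- **Model.** A (possibly randomized) transaction fee mechanism (TFM) in the trusted-hardware model takes as input a finite vector of real bids, each posted under its own identity. Using random coins, it decides which bids are confirmed (allocation rule), the payment $p_s\ge 0$ of each bid (payment rule) and the miner's revenue $\mu\ge 0$ (miner revenue rule). It also prescribes a (possibly randomized) bidding rule $\beta$, by which an honest user with true value $v\in\mathbb{R}_{\ge 0}$ posts a single bid $\beta(v)$. It is required that $\mu$ is at most the total payment of the confirmed bids (budget feasibility); that, if all users follow $\beta$, then with probability $1$ every unconfirmed user pays $0$ and every confirmed user pays at most its true value (individual rationality); and that the mechanism is weakly symmetric: for two bid vectors that agree up to a permutation, and whatever the identities, the joint law of the miner's revenue and the unordered collection of triples (bid, confirmed or not, payment) is the same. The block size is finite if there is a $k\ge 1$ such that at most $k$ bids are ever confirmed. The utility of a user with true value $v$ is $v$ (if its primary bid, i.e. the bid for its actual transaction, is confirmed; otherwise $0$) minus the total payment of all bids it posts. A bid that is nobody's primary bid is fake and has true value $0$. The utility of the miner is its revenue minus the payments of its own fake bids; the utility of a coalition is the sum over its members; the social welfare is the sum of the utilities of all users and the miner. Users and coalitions may deviate by posting arbitrarily many bids, at most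 one of them primary for each user (it carries the user's own identity, while fake bids carry any identities that are not those of honest users); the miner may also censor honest bids, without seeing them. Let $\mathcal D$ be a distribution on $\mathbb{R}_{\ge0}$. The TFM satisfies * *Bayesian UIC* if, for every user, every true value of it, and every finite set of other users, who follow $\beta$ with i.i.d. values from $\mathcal D$, no choice of posted bids gives the user a larger expected utility than following $\beta$; * *Bayesian $c$-SCP* if, for every coalition of the miner and at most $c$ users, all true values of these users, and every finite set $\mathcal H$ of honest users, who follow $\beta$ with i.i.d. values from $\mathcal D$, no choice of a subset $\mathcal H'\subseteq\mathcal H$ of forwarded users and of bids posted by the coalition gives the coalition a larger expected utility than the honest strategy (forward all of $\mathcal H$, post no fake bids, and let the users of the coalition follow $\beta$); * *Bayesian MIC* if the same holds for the miner alone; * *global SCP* if, for every finite set of users and all true values, no choice of bids posted by the coalition of the miner and all users gives a larger expected social welfare than all users following $\beta$ and no fake bids being posted. **Theorem.** Let $\mathcal D$ be a distribution on $\mathbb{R}_{\ge 0}$ with finite mean, and suppose the block size is finite. Then for every possibly randomized TFM that satisfies Bayesian UIC, Bayesian MIC, Bayesian $1$-SCP (all with respect to $\mathcal D$) and global SCP,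 and for every finite set of users with true values drawn i.i.d. from $\mathcal D$, the expected social welfare of the honest execution is zero. -/

import Mathlib

open MeasureTheory ProbabilityTheory
open scoped NNReal ENNReal

/-- The expectation of a real random variable with values in `[-∞, ∞]`: the expectation of the positive
part minus that of the negative part. It is the usual expectation if `f` is integrable, it is `±∞` if
exactly one of the two parts has infinite expectation, and it is `-∞` by convention if both have. -/
noncomputable def expectation {α : Type*} [MeasurableSpace α] (μ : Measure α) (f : α → ℝ) : EReal :=
  ((∫⁻ a, ENNReal.ofReal (f a) ∂μ : ℝ≥0∞) : EReal) - ((∫⁻ a, ENNReal.ofReal (-f a) ∂μ : ℝ≥0∞) : EReal)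

/-- A (possibly randomized) transaction fee mechanism in the trusted-hardware model, with random coins
`ω` drawn from `P`. Identities are natural numbers. The input is a bid vector `b : S → ℝ` indexed by
the finite set `S` of the identities that take part, one bid for each of them. -/
structure TFM {Ω : Type*} [MeasurableSpace Ω] (P : Measure Ω) where
  /-- The bidding rule: the law of the single bid that an honest user with the given true value posts
  (a point mass for a deterministic rule; the point mass at the value for a truthful mechanism). -/
  bidding : Kernel ℝ≥0 ℝ
  markov : IsMarkovKernel bidding
  /-- The allocation rule: whether the bid of each identity is confirmed. -/
  confirmed : (S : Finset ℕ) → (S → ℝ) → Ω → S → Bool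
  /-- The payment rule: the payment of the bid of each identity. -/
  payment : (S : Finset ℕ) → (S → ℝ) → Ω → S → ℝ
  /-- The miner revenue rule. -/
  revenue : (S : Finset ℕ) → (S → ℝ) → Ω → ℝ
  measurable_confirmed : ∀ (S : Finset ℕ) (s : S),
    Measurable fun z : (S → ℝ) × Ω => confirmed S z.1 z.2 s
  measurable_payment : ∀ (S : Finset ℕ) (s : S),
    Measurable fun z : (S → ℝ) × Ω => payment S z.1 z.2 s
  measurable_revenue : ∀ S : Finset ℕ, Measurable fun z : (S → ℝ) × Ω => revenue S z.1 z.2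
  payment_nonneg : ∀ S b ω s, 0 ≤ payment S b ω s
  revenue_nonneg : ∀ S b ω, 0 ≤ revenue S b ω
  /-- Budget feasibility: the miner receives at most what is collected from the confirmed bids. -/
  budget_feasible : ∀ S b ω,
    revenue S b ω ≤ ∑ s : S, if confirmed S b ω s = true then payment S b ω s else 0
  /-- Individual rationality: if all users follow the bidding rule, then with probability one an
  unconfirmed user pays nothing and a confirmed user pays at most its true value. -/
  individually_rational : ∀ (S : Finset ℕ) (v : ℕ → ℝ≥0),
    ∀ᵐ z ∂((Measure.pi fun s : S => bidding (v s)).prod P), ∀ s : S,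
      (confirmed S z.1 z.2 s = false → payment S z.1 z.2 s = 0) ∧
      (confirmed S z.1 z.2 s = true → payment S z.1 z.2 s ≤ v s)

namespace TFM

variable {Ω : Type*} [MeasurableSpace Ω] {P : Measure Ω}

attribute [instance] TFM.markov

/-- The block size is at most `k`: never are more than `k` bids confirmed. -/
def BlockSizeAtMost (M : TFM P) (k : ℕ) : Prop :=
  ∀ (S : Finset ℕ) (b : S → ℝ) (ω : Ω),
    (Finset.univ.filter fun s : S => M.confirmed S b ω s = true).card ≤ k

/-- The outcome: the miner revenue, and for each identity its bid, whether it is confirmed, and its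
payment. -/
def outcome (M : TFM P) (S : Finset ℕ) (b : S → ℝ) (ω : Ω) : ℝ × (S → ℝ × Bool × ℝ) :=
  (M.revenue S b ω, fun s => (b s, M.confirmed S b ω s, M.payment S b ω s))

/-- Weak symmetry: if two bid vectors agree up to a relabelling `e` of the identities, then the miner
revenue together with the *unordered* collection of the triples (bid, confirmed or not, payment) has the
same law for both. The events about this unordered collection are the measurable sets `A` of outcomes
that are invariant under permutations of the identities. -/
def IsWeaklySymmetric (M : TFM P) : Prop :=
  ∀ (S S' : Finset ℕ) (e : S ≃ S') (b : S' → ℝ) (A : Set (ℝ × (S' → ℝ × Bool × ℝ))),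
    MeasurableSet A →
    (∀ (π : Equiv.Perm S') (r : ℝ) (o : S' → ℝ × Bool × ℝ), (r, o) ∈ A → (r, o ∘ π) ∈ A) →
    P {ω | ((M.outcome S (b ∘ e) ω).1, (M.outcome S (b ∘ e) ω).2 ∘ e.symm) ∈ A} =
      P {ω | M.outcome S' b ω ∈ A}

/-- The law of the bid vector and the coins if the identities `s ∈ S` post independent bids with
laws `q s`. -/
noncomputable def execution (_M : TFM P) (S : Finset ℕ) (q : ℕ → Measure ℝ) :
    Measure ((S → ℝ) × Ω) :=
  (Measure.pi fun s : S => q s).prod P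

/-- The law of a bid of an honest user whose true value is drawn from `D`. -/
noncomputable def honestBid (M : TFM P) (D : Measure ℝ≥0) : Measure ℝ :=
  D.bind M.bidding

/-- The bid laws if the identities in `H` are honest users with true values drawn from `D`, and the
others follow the bidding rule with the given true values `v`. -/
noncomputable def followingBids (M : TFM P) (D : Measure ℝ≥0) (H : Finset ℕ) (v : ℕ → ℝ≥0) (s : ℕ) :
    Measure ℝ :=
  if s ∈ H then M.honestBid D else M.bidding (v s)

/-- The bid laws if the identities in `H` are honest users with true values drawn from `D`, and the
others post the given bids `b`. -/
noncomputable def deviatingBids (M : TFM P) (D : Measure ℝ≥0) (H : Finset ℕ) (b : ℕ → ℝ) (s : ℕ) :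
    Measure ℝ :=
  if s ∈ H then M.honestBid D else Measure.dirac (b s)

/-- The joint utility of the users in `C` when the identities in `S` post the bids `b`, those in `H`
being outside users. All identities in `S` outside `H` belong to the strategic party, which makes their
payments. A bid under the identity of a user `i ∈ C` is the primary bid of `i` and is worth `v i` when
confirmed; every other bid of the party is a fake bid and worth nothing. -/
noncomputable def userUtility (M : TFM P) (H C : Finset ℕ) (v : ℕ → ℝ≥0) (S : Finset ℕ)
    (z : (S → ℝ) × Ω) : ℝ :=
  ∑ s : S, if (s : ℕ) ∈ H then 0 else
    (if (s : ℕ) ∈ C ∧ M.confirmed S z.1 z.2 s = true then (v s : ℝ) else 0) - M.payment S z.1 z.2 s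

/-- The joint utility of the miner and the users in `C`. -/
noncomputable def coalitionUtility (M : TFM P) (H C : Finset ℕ) (v : ℕ → ℝ≥0) (S : Finset ℕ)
    (z : (S → ℝ) × Ω) : ℝ :=
  M.userUtility H C v S z + M.revenue S z.1 z.2

/-- Bayesian user incentive compatibility: a user `i` with any true value, facing any set `H` of
other users with values drawn from `D`, cannot gain by posting any bids under any finite set `F` of
identities (with `i ∈ F` iff it posts a primary bid). -/
def BayesianUIC (M : TFM P) (D : Measure ℝ≥0) : Prop :=
  ∀ (H : Finset ℕ) (i : ℕ), i ∉ H → ∀ (v : ℕ → ℝ≥0) (F : Finset ℕ), Disjoint F H → ∀ b : ℕ → ℝ,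
    expectation (M.execution (H ∪ F) (M.deviatingBids D H b)) (M.userUtility H {i} v (H ∪ F)) ≤
      expectation (M.execution (H ∪ {i}) (M.followingBids D H v)) (M.userUtility H {i} v (H ∪ {i}))

/-- A coalition of the miner and the users in `C`, with any true values, facing any set `H` of honest
users with values drawn from `D`, cannot gain by forwarding only the bids of a subset `H'` and posting
any bids under any finite set `F` of identities. -/
def BayesianCoalitionProof (M : TFM P) (D : Measure ℝ≥0) (C : Finset ℕ) : Prop :=
  ∀ H : Finset ℕ, Disjoint C H → ∀ (v : ℕ → ℝ≥0) (H' : Finset ℕ), H' ⊆ H →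
    ∀ F : Finset ℕ, Disjoint F H → ∀ b : ℕ → ℝ,
      expectation (M.execution (H' ∪ F) (M.deviatingBids D H b)) (M.coalitionUtility H C v (H' ∪ F)) ≤
        expectation (M.execution (H ∪ C) (M.followingBids D H v)) (M.coalitionUtility H C v (H ∪ C))

/-- Bayesian miner incentive compatibility. -/
def BayesianMIC (M : TFM P) (D : Measure ℝ≥0) : Prop :=
  M.BayesianCoalitionProof D ∅

/-- Bayesian `c`-side-contract-proofness. -/
def BayesianSCP (M : TFM P) (D : Measure ℝ≥0) (c : ℕ) : Prop :=
  ∀ C : Finset ℕ, C.card ≤ c → M.BayesianCoalitionProof D C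

/-- Global side-contract-proofness: for every set `U` of users and all true values `v`, the miner and
all users together cannot increase the expected social welfare by posting any bids `b` under any finite
set `F` of identities. -/
def GlobalSCP (M : TFM P) : Prop :=
  ∀ (U : Finset ℕ) (v : ℕ → ℝ≥0) (F : Finset ℕ) (b : ℕ → ℝ),
    expectation (M.execution F fun s => Measure.dirac (b s)) (M.coalitionUtility ∅ U v F) ≤
      expectation (M.execution U fun s => M.bidding (v s)) (M.coalitionUtility ∅ U v U)

/-- The expected social welfare (the sum of the utilities of all users and the miner) in an honest
execution with user set `U` and true values drawn independently from `D`; the first factor of the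
underlying measure is the law of the pairs (true value, bid). -/
noncomputable def expectedSocialWelfare (M : TFM P) (D : Measure ℝ≥0) (U : Finset ℕ) : EReal :=
  expectation ((Measure.pi fun _ : U => D ⊗ₘ M.bidding).prod P) fun z =>
    (∑ s : U, ((if M.confirmed U (fun t => (z.1 t).2) z.2 s = true then ((z.1 s).1 : ℝ) else 0) -
      M.payment U (fun t => (z.1 t).2) z.2 s)) + M.revenue U (fun t => (z.1 t).2) z.2

end TFM

/-!
The bidding rule is realized by a function of the true value and of a uniform private coin, so
that all honest executions live on one probability space: i.i.d. values `V`, private coins `θ`,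
and the coins `ω` of the mechanism. Write `x_i(v)` for the probability that `i` is confirmed, and
`W_U(v)` for the expected welfare of the honest execution with users `U` and values `v`.

Global side-contract-proofness says that `W_U(v)` is the best welfare that any bids achieve. Hence
`x_i` is a subgradient of `W_U` in the value of `i` (`welfare_subgradient`), and a user with value
zero can be dropped without changing the welfare (`welfare_update_zero`). Averaged over the values
of the others, `x_i` is also a subgradient of the expected utility of `i`, by Bayesian UIC, and of
the expected utility of the coalition of `i` and the miner, by Bayesian 1-SCP. Functions on the
half-line with a common subgradient differ by a constant (`sub_eq_sub_of_common_subgradient`).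
Since the utility is zero at value zero, this has two consequences.

* The expected revenue does not depend on the value of `i`. At value zero the bid of `i` costs
  nothing, so by MIC the miner could post it as a fake bid; the expected revenue therefore does not
  grow with the number of users, and it is zero (`expectedRevenue_eq_zero`).
* The expected utility of `i` is `a(U) - a(U \ {i})`, where `a(U)` is the expected welfare
  (`integral_utility_eq_marginal`): every user receives its marginal contribution.

Without revenue the utilities add up to the welfare, so `a(U) = ∑ i ∈ U, (a(U) - a(U \ {i}))`.
Solving this recursion gives `a(U) = ∑ i ∈ U, a({i})` (`expectedWelfare_eq_sum`), which by weak
symmetry is `|U|` times a constant `α ≥ 0`. On the other hand at most `k` users are confirmed, so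
that `a(U) ≤ k K + |U| E[(v - K)⁺]` for every `K` (`expectedWelfare_le`). Letting first `|U|` and
then `K` go to infinity yields `α = 0`, because the mean is finite.
-/

/-! ### Auxiliary facts on measures and expectations -/

section Expectation

variable {α β : Type*} [MeasurableSpace α] [MeasurableSpace β]

lemma expectation_eq_integral {μ : Measure α} {f : α → ℝ} (hf : Integrable f μ) :
    expectation μ f = ((∫ a, f a ∂μ : ℝ) : EReal) := by
  have h1 : ∫⁻ a, ENNReal.ofReal (f a) ∂μ ≠ ∞ := hf.lintegral_lt_top.ne
  have h2 : ∫⁻ a, ENNReal.ofReal (-f a) ∂μ ≠ ∞ := hf.neg.lintegral_lt_top.ne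
  rw [integral_eq_lintegral_pos_part_sub_lintegral_neg_part hf, expectation, EReal.coe_sub,
    EReal.coe_ennreal_toReal h1, EReal.coe_ennreal_toReal h2]

lemma expectation_map {μ : Measure α} {φ : α → β} (hφ : Measurable φ) {f : β → ℝ}
    (hf : Measurable f) : expectation (μ.map φ) f = expectation μ (f ∘ φ) := by
  simp only [expectation]
  rw [lintegral_map (by fun_prop) hφ, lintegral_map (by fun_prop) hφ]
  rfl

/-- If no fixed choice of `x` gives an expectation above `c`, then neither does a random choice. -/
lemma integral_prod_le_of_expectation_le {μ : Measure α} [IsProbabilityMeasure μ] {ν : Measure β}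
    [IsProbabilityMeasure ν] {h : α × β → ℝ} (hh : Integrable h (μ.prod ν)) {c : ℝ}
    (hc : ∀ x, expectation ν (fun y => h (x, y)) ≤ (c : EReal)) :
    ∫ z, h z ∂(μ.prod ν) ≤ c := by
  rw [integral_prod _ hh]
  have hle : ∀ᵐ x ∂μ, ∫ y, h (x, y) ∂ν ≤ c := by
    filter_upwards [hh.prod_right_ae] with x hx
    have := hc x
    rw [expectation_eq_integral hx] at this
    exact_mod_cast this
  calc ∫ x, ∫ y, h (x, y) ∂ν ∂μ ≤ ∫ _, c ∂μ :=
        integral_mono_ae hh.integral_prod_left (integrable_const c) hle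
    _ = c := by simp

lemma integrable_prod_of_nonneg_of_le {μ : Measure α} [IsProbabilityMeasure μ] {ν : Measure β}
    [IsProbabilityMeasure ν] {f : α × β → ℝ} (hf : Measurable f) (h0 : ∀ z, 0 ≤ f z)
    (hi : ∀ x, Integrable (fun y => f (x, y)) ν) {B : α → ℝ} (hB : Integrable B μ)
    (hle : ∀ x, ∫ y, f (x, y) ∂ν ≤ B x) : Integrable f (μ.prod ν) := by
  rw [integrable_prod_iff hf.aestronglyMeasurable]
  refine ⟨.of_forall hi, hB.mono' ?_ (.of_forall fun x => ?_)⟩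
  · exact (hf.norm.stronglyMeasurable.integral_prod_right').aestronglyMeasurable
  · have : ∀ y, ‖f (x, y)‖ = f (x, y) := fun y => Real.norm_of_nonneg (h0 _)
    simp only [this]
    rw [Real.norm_of_nonneg (integral_nonneg fun y => h0 _)]
    exact hle x

/-- For a law of finite mean, the expected excess over a threshold vanishes as the threshold grows. -/
lemma tendsto_integral_excess {D : Measure ℝ≥0}
    (hmean : ∫⁻ v, (v : ℝ≥0∞) ∂D < ∞) :
    Filter.Tendsto (fun K : ℕ => ∫ v : ℝ≥0, ((v - K : ℝ≥0) : ℝ) ∂D) Filter.atTop (nhds 0) := by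
  have hint : Integrable (fun v : ℝ≥0 => (v : ℝ)) D :=
    ⟨by fun_prop, by simpa [HasFiniteIntegral] using hmean⟩
  rw [← integral_zero ℝ≥0 ℝ (μ := D)]
  refine tendsto_integral_of_dominated_convergence _
    (fun K => Measurable.aestronglyMeasurable (by fun_prop)) hint
    (fun K => .of_forall fun v => ?_) (.of_forall fun v => ?_)
  · rw [Real.norm_of_nonneg (by positivity)]
    exact_mod_cast tsub_le_self
  · refine tendsto_const_nhds.congr' ?_
    filter_upwards [Filter.eventually_ge_atTop ⌈v⌉₊] with K hK
    have : v ≤ K := (Nat.le_ceil v).trans (by exact_mod_cast hK)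
    simp [tsub_eq_zero_of_le this]

end Expectation

section InfiniteProduct

variable {X : Type*} [MeasurableSpace X]

/-- Resampling one coordinate of an i.i.d. sequence does not change its law. -/
lemma measurePreserving_update_infinitePi (μ : Measure X) [IsProbabilityMeasure μ] (i : ℕ) :
    MeasurePreserving (fun p : X × (ℕ → X) => Function.update p.2 i p.1)
      (μ.prod (Measure.infinitePi fun _ : ℕ => μ)) (Measure.infinitePi fun _ : ℕ => μ) := by
  have hm : Measurable (fun p : X × (ℕ → X) => Function.update p.2 i p.1) := by
    refine measurable_pi_lambda _ fun j => ?_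
    by_cases h : j = i
    · subst h; simpa using measurable_fst
    · simp only [Function.update_of_ne h]; fun_prop
  refine ⟨hm, Measure.eq_infinitePi _ fun s t ht => ?_⟩
  rw [Measure.map_apply hm (MeasurableSet.pi s.countable_toSet fun j _ => ht j)]
  have hset : (fun p : X × (ℕ → X) => Function.update p.2 i p.1) ⁻¹' (s : Set ℕ).pi t =
      (if i ∈ s then t i else Set.univ) ×ˢ ((s.erase i : Finset ℕ) : Set ℕ).pi t := by
    ext p
    simp only [Set.mem_preimage, Set.mem_pi, Finset.mem_coe, Set.mem_prod, Finset.mem_erase]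
    constructor
    · intro h
      refine ⟨?_, fun j hj => by simpa [Function.update_of_ne hj.1] using h j hj.2⟩
      split_ifs with his
      · simpa using h i his
      · trivial
    · rintro ⟨h1, h2⟩ j hj
      by_cases hji : j = i
      · subst hji; simpa [hj] using h1
      · simpa [Function.update_of_ne hji] using h2 j ⟨hji, hj⟩
  rw [hset, Measure.prod_prod, Measure.infinitePi_pi _ fun j _ => ht j]
  split_ifs with his
  · rw [Finset.mul_prod_erase s (fun j => μ (t j)) his]
  · rw [Finset.erase_eq_of_notMem his]; simp

lemma map_pi_infinitePi {Y : Type*} [MeasurableSpace Y] (μ : Measure X) [IsProbabilityMeasure μ]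
    (S : Finset ℕ) {φ : ℕ → X → Y} (hφ : ∀ s, Measurable (φ s)) :
    (Measure.infinitePi fun _ : ℕ => μ).map (fun ξ (s : S) => φ s (ξ s)) =
      Measure.pi fun s : S => μ.map (φ s) := by
  have : ∀ s : S, IsProbabilityMeasure (μ.map (φ s)) := fun s =>
    Measure.isProbabilityMeasure_map (hφ s).aemeasurable
  rw [← Measure.pi_map_pi (fun s : S => (hφ s).aemeasurable),
    ← Measure.infinitePi_map_restrict (μ := fun _ : ℕ => μ),
    Measure.map_map (by fun_prop) (by fun_prop)]
  rfl

lemma map_pi_prod_infinitePi {X' Y : Type*} [MeasurableSpace X'] [MeasurableSpace Y]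
    (μ : Measure X) [IsProbabilityMeasure μ] (ν : Measure X') [IsProbabilityMeasure ν]
    (S : Finset ℕ) {φ : ℕ → X × X' → Y} (hφ : ∀ s, Measurable (φ s)) :
    ((Measure.infinitePi fun _ : ℕ => μ).prod (Measure.infinitePi fun _ : ℕ => ν)).map
        (fun p (s : S) => φ s (p.1 s, p.2 s)) =
      Measure.pi fun s : S => (μ.prod ν).map (φ s) := by
  have : ∀ s : S, IsProbabilityMeasure ((μ.prod ν).map (φ s)) := fun s =>
    Measure.isProbabilityMeasure_map (hφ s).aemeasurable
  rw [← Measure.pi_map_pi (fun s : S => (hφ s).aemeasurable),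
    ← (measurePreserving_arrowProdEquivProdArrow X X' S (fun _ => μ) (fun _ => ν)).symm.map_eq,
    ← Measure.infinitePi_map_restrict (μ := fun _ : ℕ => μ),
    ← Measure.infinitePi_map_restrict (μ := fun _ : ℕ => ν),
    Measure.map_prod_map _ _ (by fun_prop) (by fun_prop),
    Measure.map_map (by fun_prop) (by fun_prop), Measure.map_map (by fun_prop) (by fun_prop)]
  rfl

end InfiniteProduct

section Subgradient

/-- Two functions on the half-line with a common subgradient at every point differ by a constant. -/
lemma sub_eq_sub_of_common_subgradient {f h x : ℝ≥0 → ℝ}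
    (hf : ∀ v w : ℝ≥0, f w + ((v : ℝ) - w) * x w ≤ f v)
    (hh : ∀ v w : ℝ≥0, h w + ((v : ℝ) - w) * x w ≤ h v)
    (v : ℝ≥0) : f v - f 0 = h v - h 0 := by
  -- Over one step, the increments of both functions lie between the same two bounds.
  have step : ∀ a b : ℝ≥0, |(f b - f a) - (h b - h a)| ≤ ((b : ℝ) - a) * (x b - x a) := by
    intro a b
    have := hf a b; have := hf b a; have := hh a b; have := hh b a
    rw [abs_le]; constructor <;> nlinarith
  -- Telescoping over `n` equal steps leaves an error of order `1 / n`.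
  have tele : ∀ n m : ℕ, |(f (m * (v / n)) - f 0) - (h (m * (v / n)) - h 0)| ≤
      ((v / n : ℝ≥0) : ℝ) * (x (m * (v / n)) - x 0) := by
    intro n m
    induction m with
    | zero => simp
    | succ m ih =>
      have hs := step (m * (v / n)) ((m + 1 : ℕ) * (v / n))
      have e : (((m + 1 : ℕ) * (v / n) : ℝ≥0) : ℝ) - ((m * (v / n) : ℝ≥0) : ℝ) =
          ((v / n : ℝ≥0) : ℝ) := by push_cast; ring
      rw [e] at hs
      rw [abs_le] at hs ih ⊢
      constructor <;> nlinarith [hs.1, hs.2, ih.1, ih.2]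
  have key : ∀ n : ℕ, |(f v - f 0) - (h v - h 0)| ≤ (v * (x v - x 0)) * (1 / ((n : ℝ) + 1)) := by
    intro n
    have := tele (n + 1) (n + 1)
    have e : ((n + 1 : ℕ) : ℝ≥0) * (v / (n + 1 : ℕ)) = v := by
      field_simp
    rw [e] at this
    refine this.trans (le_of_eq ?_)
    push_cast; ring
  have lim : Filter.Tendsto (fun n : ℕ => (v * (x v - x 0)) * (1 / ((n : ℝ) + 1))) Filter.atTop
      (nhds ((v * (x v - x 0)) * 0)) := tendsto_one_div_add_atTop_nhds_zero_nat.const_mul _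
  have h0 := ge_of_tendsto' lim key
  rw [mul_zero] at h0
  exact sub_eq_zero.1 (abs_nonpos_iff.1 h0)

end Subgradient

namespace TFM

variable {Ω : Type*} [MeasurableSpace Ω] {P : Measure Ω}

/-! ### Honest executions on a common probability space -/

/-- `g` realizes the bidding rule: a user with value `v` posts `g v t`, where `t` is uniform on the
unit interval. -/
structure Simulates (M : TFM P) (g : ℝ≥0 → unitInterval → ℝ) : Prop where
  measurable : Measurable (Function.uncurry g)
  map_eq : ∀ v, (volume : Measure unitInterval).map (g v) = M.bidding v

lemma exists_simulates (M : TFM P) : ∃ g, M.Simulates g := by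
  obtain ⟨g, hg, hmap⟩ := Kernel.exists_measurable_map_eq_unitInterval M.bidding
  exact ⟨g, hg, hmap⟩

/-- The values of all identities, drawn independently from `D`. -/
noncomputable def valueLaw (D : Measure ℝ≥0) [IsProbabilityMeasure D] : Measure (ℕ → ℝ≥0) :=
  Measure.infinitePi fun _ : ℕ => D

/-- The private coins of all identities, independent and uniform on the unit interval, together with
the coins of the mechanism. -/
noncomputable def coinLaw (P : Measure Ω) : Measure ((ℕ → unitInterval) × Ω) :=
  (Measure.infinitePi fun _ : ℕ => (volume : Measure unitInterval)).prod P

instance (D : Measure ℝ≥0) [IsProbabilityMeasure D] : IsProbabilityMeasure (valueLaw D) := by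
  unfold valueLaw; infer_instance

instance [IsProbabilityMeasure P] : IsProbabilityMeasure (coinLaw P) := by
  unfold coinLaw; infer_instance

/-- The bid vector of `S` and the coins of the mechanism, if every identity follows the bidding rule
with the values `v` and the coins `p`. -/
def play (g : ℝ≥0 → unitInterval → ℝ) (S : Finset ℕ) (v : ℕ → ℝ≥0) (p : (ℕ → unitInterval) × Ω) :
    (S → ℝ) × Ω :=
  (fun s => g (v s) (p.1 s), p.2)

/-- The indicator of the event that the bid of `i` is confirmed; zero if `i` does not take part. -/
noncomputable def confirmedAt (M : TFM P) (S : Finset ℕ) (z : (S → ℝ) × Ω) (i : ℕ) : ℝ :=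
  if h : i ∈ S then (if M.confirmed S z.1 z.2 ⟨i, h⟩ = true then 1 else 0) else 0

/-- The payment of `i`; zero if `i` does not take part. -/
noncomputable def paymentAt (M : TFM P) (S : Finset ℕ) (z : (S → ℝ) × Ω) (i : ℕ) : ℝ :=
  if h : i ∈ S then M.payment S z.1 z.2 ⟨i, h⟩ else 0

/-- The revenue as a function of bids and coins. -/
def revenueAt (M : TFM P) (S : Finset ℕ) (z : (S → ℝ) × Ω) : ℝ := M.revenue S z.1 z.2

section Pointwise

variable (M : TFM P) (S : Finset ℕ)

lemma measurable_confirmedAt (i : ℕ) : Measurable fun z => M.confirmedAt S z i := by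
  unfold confirmedAt
  by_cases h : i ∈ S
  · simp only [h, dite_true]
    exact Measurable.ite (measurableSet_eq_fun (M.measurable_confirmed S ⟨i, h⟩) measurable_const)
      measurable_const measurable_const
  · simp only [h, dite_false]; exact measurable_const

lemma measurable_paymentAt (i : ℕ) : Measurable fun z => M.paymentAt S z i := by
  unfold paymentAt
  by_cases h : i ∈ S
  · simp only [h, dite_true]; exact M.measurable_payment S ⟨i, h⟩
  · simp only [h, dite_false]; exact measurable_const

lemma measurable_revenueAt : Measurable (M.revenueAt S) := M.measurable_revenue S

lemma confirmedAt_nonneg (z : (S → ℝ) × Ω) (i : ℕ) : 0 ≤ M.confirmedAt S z i := by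
  unfold confirmedAt; split_ifs <;> norm_num

lemma confirmedAt_le_one (z : (S → ℝ) × Ω) (i : ℕ) : M.confirmedAt S z i ≤ 1 := by
  unfold confirmedAt; split_ifs <;> norm_num

lemma paymentAt_nonneg (z : (S → ℝ) × Ω) (i : ℕ) : 0 ≤ M.paymentAt S z i := by
  unfold paymentAt; split_ifs
  exacts [M.payment_nonneg _ _ _ _, le_rfl]

lemma revenueAt_nonneg (z : (S → ℝ) × Ω) : 0 ≤ M.revenueAt S z := M.revenue_nonneg _ _ _

lemma revenueAt_le (z : (S → ℝ) × Ω) : M.revenueAt S z ≤ ∑ i ∈ S, M.paymentAt S z i := by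
  rw [← Finset.sum_coe_sort S (fun i => M.paymentAt S z i)]
  refine (M.budget_feasible S z.1 z.2).trans (Finset.sum_le_sum fun s _ => ?_)
  simp only [paymentAt, s.2, dite_true]
  split_ifs
  exacts [le_rfl, M.payment_nonneg _ _ _ _]

lemma sum_confirmedAt_le {k : ℕ} (hM : M.BlockSizeAtMost k) (z : (S → ℝ) × Ω) :
    ∑ i ∈ S, M.confirmedAt S z i ≤ k := by
  rw [← Finset.sum_coe_sort S (fun i => M.confirmedAt S z i)]
  have := hM S z.1 z.2
  simp only [confirmedAt, Finset.coe_mem, dite_true, Finset.sum_boole]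
  exact_mod_cast this

lemma userUtility_eq (H C : Finset ℕ) (v : ℕ → ℝ≥0) (z : (S → ℝ) × Ω) :
    M.userUtility H C v S z = ∑ i ∈ S, if i ∈ H then 0 else
      ((if i ∈ C then (v i : ℝ) else 0) * M.confirmedAt S z i - M.paymentAt S z i) := by
  rw [userUtility, ← Finset.sum_coe_sort S (fun i => if i ∈ H then 0 else
      ((if i ∈ C then (v i : ℝ) else 0) * M.confirmedAt S z i - M.paymentAt S z i))]
  refine Finset.sum_congr rfl fun s _ => ?_
  simp only [confirmedAt, paymentAt, s.2, dite_true]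
  split_ifs <;> simp_all

lemma userUtility_union_singleton {H : Finset ℕ} {i : ℕ} (hi : i ∉ H) (C : Finset ℕ)
    (v : ℕ → ℝ≥0) (z : ((H ∪ {i} : Finset ℕ) → ℝ) × Ω) :
    M.userUtility H C v (H ∪ {i}) z =
      (if i ∈ C then (v i : ℝ) else 0) * M.confirmedAt (H ∪ {i}) z i
        - M.paymentAt (H ∪ {i}) z i := by
  rw [userUtility_eq, Finset.sum_eq_single i]
  · simp [hi]
  · intro j hj hji
    have : j ∈ H := by simpa [hji] using hj
    simp [this]
  · intro h; simp at h

lemma measurable_userUtility (H C : Finset ℕ) (v : ℕ → ℝ≥0) :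
    Measurable (M.userUtility H C v S) := by
  rw [funext (M.userUtility_eq S H C v)]
  refine Finset.measurable_sum _ fun i _ => ?_
  by_cases h : i ∈ H
  · simp only [h, if_true]; exact measurable_const
  · simp only [h, if_false]
    exact ((M.measurable_confirmedAt S i).const_mul _).sub (M.measurable_paymentAt S i)

lemma measurable_coalitionUtility (H C : Finset ℕ) (v : ℕ → ℝ≥0) :
    Measurable (M.coalitionUtility H C v S) :=
  (M.measurable_userUtility S H C v).add (M.measurable_revenue S)

end Pointwise

section Play

variable {M : TFM P} {g : ℝ≥0 → unitInterval → ℝ}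

lemma Simulates.measurable_play (hg : M.Simulates g) (S : Finset ℕ) :
    Measurable fun q : (ℕ → ℝ≥0) × ((ℕ → unitInterval) × Ω) => play g S q.1 q.2 := by
  refine Measurable.prodMk (measurable_pi_lambda _ fun s => ?_) (by fun_prop)
  exact hg.measurable.comp (f := fun q : (ℕ → ℝ≥0) × ((ℕ → unitInterval) × Ω) =>
    (q.1 s, q.2.1 s)) (by fun_prop)

lemma Simulates.measurable_play_right (hg : M.Simulates g) (S : Finset ℕ) (v : ℕ → ℝ≥0) :
    Measurable (play (Ω := Ω) g S v) :=
  (hg.measurable_play S).comp measurable_prodMk_left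

lemma play_congr {Ω : Type*} {g : ℝ≥0 → unitInterval → ℝ} {S : Finset ℕ}
    {v w : ℕ → ℝ≥0} (h : ∀ s ∈ S, v s = w s) :
    play (Ω := Ω) g S v = play g S w := by
  funext p
  simp only [play, Prod.mk.injEq, and_true]
  funext s
  rw [h s s.2]

/-! ### Interim allocation, payments and revenue -/

section Interim

variable (M g) (S : Finset ℕ) (i : ℕ) (v : ℕ → ℝ≥0)

/-- The probability that `i` is confirmed when the identities in `S` follow the bidding rule with
values `v`. -/
noncomputable def allocProb : ℝ := ∫ p, M.confirmedAt S (play g S v p) i ∂coinLaw P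

/-- The expected payment of `i` when the identities in `S` follow the bidding rule with values `v`. -/
noncomputable def meanPayment : ℝ := ∫ p, M.paymentAt S (play g S v p) i ∂coinLaw P

/-- The expected revenue when the identities in `S` follow the bidding rule with values `v`. -/
noncomputable def meanRevenue : ℝ := ∫ p, M.revenueAt S (play g S v p) ∂coinLaw P

/-- The expected social welfare when the users in `S` follow the bidding rule with values `v`. -/
noncomputable def welfare : ℝ :=
  ∑ i ∈ S, ((v i : ℝ) * M.allocProb g S i v - M.meanPayment g S i v) + M.meanRevenue g S v

lemma allocProb_nonneg : 0 ≤ M.allocProb g S i v :=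
  integral_nonneg fun _ => M.confirmedAt_nonneg S _ i

lemma meanPayment_nonneg : 0 ≤ M.meanPayment g S i v :=
  integral_nonneg fun _ => M.paymentAt_nonneg S _ i

lemma meanRevenue_nonneg : 0 ≤ M.meanRevenue g S v :=
  integral_nonneg fun _ => M.revenueAt_nonneg S _

variable {M g S v}

lemma welfare_congr {w : ℕ → ℝ≥0} (h : ∀ s ∈ S, v s = w s) :
    M.welfare g S v = M.welfare g S w := by
  unfold welfare allocProb meanPayment meanRevenue
  rw [play_congr h]
  congr 1
  exact Finset.sum_congr rfl fun i hi => by rw [h i hi]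

end Interim

variable [IsProbabilityMeasure P]

lemma Simulates.execution_bidding (hg : M.Simulates g) (S : Finset ℕ) (v : ℕ → ℝ≥0) :
    M.execution S (fun s => M.bidding (v s)) = (coinLaw P).map (play g S v) := by
  have hm : ∀ s, Measurable (g (v s)) := fun s => hg.measurable.comp measurable_prodMk_left
  rw [execution]
  simp only [← hg.map_eq]
  rw [← map_pi_infinitePi (volume : Measure unitInterval) S hm]
  conv_lhs => rw [← Measure.map_id (μ := P)]
  rw [Measure.map_prod_map _ _ (by fun_prop) (by fun_prop)]
  rfl

/-- Individual rationality for the realization `g`. -/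
lemma Simulates.ae_paymentAt_le (hg : M.Simulates g) (S : Finset ℕ) (v : ℕ → ℝ≥0) :
    ∀ᵐ p ∂coinLaw P, ∀ i, M.paymentAt S (play g S v p) i ≤
      v i * M.confirmedAt S (play g S v p) i := by
  have h := M.individually_rational S v
  change ∀ᵐ z ∂(M.execution S fun s => M.bidding (v s)), _ at h
  rw [hg.execution_bidding] at h
  filter_upwards [ae_of_ae_map (hg.measurable_play_right S v).aemeasurable h] with p hp i
  unfold paymentAt confirmedAt
  split_ifs with his hc
  · simpa using (hp ⟨i, his⟩).2 hc
  · simpa using ((hp ⟨i, his⟩).1 (by simpa using hc)).le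
  · simp

variable (S : Finset ℕ) (i : ℕ) (v : ℕ → ℝ≥0)

lemma Simulates.integrable_confirmedAt (hg : M.Simulates g) :
    Integrable (fun p => M.confirmedAt S (play g S v p) i) (coinLaw P) := by
  refine Integrable.of_bound (C := 1)
    ((M.measurable_confirmedAt S i).comp (hg.measurable_play_right S v)).aestronglyMeasurable
    (.of_forall fun p => ?_)
  rw [Real.norm_of_nonneg (M.confirmedAt_nonneg S _ i)]
  exact M.confirmedAt_le_one S _ i

lemma Simulates.integrable_paymentAt (hg : M.Simulates g) :
    Integrable (fun p => M.paymentAt S (play g S v p) i) (coinLaw P) := by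
  refine ((hg.integrable_confirmedAt S i v).const_mul (v i : ℝ)).mono'
    ((M.measurable_paymentAt S i).comp (hg.measurable_play_right S v)).aestronglyMeasurable ?_
  filter_upwards [hg.ae_paymentAt_le S v] with p hp
  rw [Real.norm_of_nonneg (M.paymentAt_nonneg S _ i)]
  exact hp i

lemma Simulates.integrable_revenueAt (hg : M.Simulates g) :
    Integrable (fun p => M.revenueAt S (play g S v p)) (coinLaw P) := by
  refine (integrable_finsetSum S fun i _ => hg.integrable_paymentAt S i v).mono'
    ((M.measurable_revenueAt S).comp (hg.measurable_play_right S v)).aestronglyMeasurable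
    (.of_forall fun p => ?_)
  rw [Real.norm_of_nonneg (M.revenueAt_nonneg S _)]
  exact M.revenueAt_le S _

lemma Simulates.allocProb_le_one (hg : M.Simulates g) : M.allocProb g S i v ≤ 1 := by
  calc M.allocProb g S i v ≤ ∫ _, (1 : ℝ) ∂coinLaw P :=
        integral_mono (hg.integrable_confirmedAt S i v) (integrable_const _)
          fun p => M.confirmedAt_le_one S _ i
    _ = 1 := by simp

lemma Simulates.sum_allocProb_le (hg : M.Simulates g) {k : ℕ} (hM : M.BlockSizeAtMost k) :
    ∑ i ∈ S, M.allocProb g S i v ≤ k := by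
  unfold allocProb
  rw [← integral_finsetSum _ fun i _ => hg.integrable_confirmedAt S i v]
  calc _ ≤ ∫ _, (k : ℝ) ∂coinLaw P :=
        integral_mono (integrable_finsetSum _ fun i _ => hg.integrable_confirmedAt S i v)
          (integrable_const _) fun p => M.sum_confirmedAt_le S hM _
    _ = k := by simp

lemma Simulates.meanPayment_le (hg : M.Simulates g) :
    M.meanPayment g S i v ≤ v i * M.allocProb g S i v := by
  unfold allocProb meanPayment
  rw [← integral_const_mul]
  refine integral_mono_ae (hg.integrable_paymentAt S i v)
    ((hg.integrable_confirmedAt S i v).const_mul _) ?_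
  filter_upwards [hg.ae_paymentAt_le S v] with p hp using hp i

lemma Simulates.meanRevenue_le (hg : M.Simulates g) :
    M.meanRevenue g S v ≤ ∑ i ∈ S, M.meanPayment g S i v := by
  unfold meanRevenue meanPayment
  rw [← integral_finsetSum _ fun i _ => hg.integrable_paymentAt S i v]
  exact integral_mono (hg.integrable_revenueAt S v)
    (integrable_finsetSum _ fun i _ => hg.integrable_paymentAt S i v)
    fun p => M.revenueAt_le S _

lemma Simulates.welfare_nonneg (hg : M.Simulates g) : 0 ≤ M.welfare g S v :=
  add_nonneg (Finset.sum_nonneg fun i _ => sub_nonneg.2 (hg.meanPayment_le S i v))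
    (M.meanRevenue_nonneg g S v)

/-- The payments cover the revenue, so the welfare is at most the value of the confirmed bids. -/
lemma Simulates.welfare_le (hg : M.Simulates g) :
    M.welfare g S v ≤ ∑ i ∈ S, (v i : ℝ) * M.allocProb g S i v := by
  have := hg.meanRevenue_le S v
  rw [welfare, Finset.sum_sub_distrib]
  linarith

lemma Simulates.measurable_allocProb (hg : M.Simulates g) : Measurable (M.allocProb g S i) :=
  (((M.measurable_confirmedAt S i).comp
    (hg.measurable_play S)).stronglyMeasurable.integral_prod_right').measurable

lemma Simulates.measurable_meanPayment (hg : M.Simulates g) : Measurable (M.meanPayment g S i) :=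
  (((M.measurable_paymentAt S i).comp
    (hg.measurable_play S)).stronglyMeasurable.integral_prod_right').measurable

lemma Simulates.measurable_meanRevenue (hg : M.Simulates g) : Measurable (M.meanRevenue g S) :=
  (((M.measurable_revenueAt S).comp
    (hg.measurable_play S)).stronglyMeasurable.integral_prod_right').measurable

lemma Simulates.measurable_welfare (hg : M.Simulates g) : Measurable (M.welfare g S) := by
  unfold welfare
  refine (Finset.measurable_sum _ fun i _ => ?_).add (hg.measurable_meanRevenue S)
  exact (Measurable.mul (by fun_prop) (hg.measurable_allocProb S i)).sub
    (hg.measurable_meanPayment S i)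

/-! ### Global side-contract-proofness in interim form -/

/-- The expected joint utility of the miner and the users in `C` with values `v`, if the party
controls all identities in `F`, which follow the bidding rule with values `w`. -/
lemma Simulates.integral_coalitionUtility (hg : M.Simulates g) (C F : Finset ℕ)
    (w : ℕ → ℝ≥0) :
    Integrable (fun p => M.coalitionUtility ∅ C v F (play g F w p)) (coinLaw P) ∧
    ∫ p, M.coalitionUtility ∅ C v F (play g F w p) ∂coinLaw P =
      ∑ i ∈ F, ((if i ∈ C then (v i : ℝ) else 0) * M.allocProb g F i w - M.meanPayment g F i w)
        + M.meanRevenue g F w := by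
  have hi : ∀ i ∈ F, Integrable (fun p => (if i ∈ C then (v i : ℝ) else 0) *
      M.confirmedAt F (play g F w p) i - M.paymentAt F (play g F w p) i) (coinLaw P) := fun i _ =>
    ((hg.integrable_confirmedAt F i w).const_mul _).sub (hg.integrable_paymentAt F i w)
  have e : (fun p => M.coalitionUtility ∅ C v F (play g F w p)) = fun p =>
      (∑ i ∈ F, ((if i ∈ C then (v i : ℝ) else 0) *
        M.confirmedAt F (play g F w p) i - M.paymentAt F (play g F w p) i))
        + M.revenueAt F (play g F w p) := by
    funext p
    rw [coalitionUtility, userUtility_eq]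
    simp [revenueAt]
  rw [e]
  refine ⟨(integrable_finsetSum _ hi).add (hg.integrable_revenueAt F w), ?_⟩
  rw [integral_add (integrable_finsetSum _ hi) (hg.integrable_revenueAt F w),
    integral_finsetSum _ hi]
  congr 1
  refine Finset.sum_congr rfl fun i _ => ?_
  rw [integral_sub ((hg.integrable_confirmedAt F i w).const_mul _) (hg.integrable_paymentAt F i w),
    integral_const_mul]
  rfl

lemma Simulates.integral_coalitionUtility_self (hg : M.Simulates g) :
    ∫ p, M.coalitionUtility ∅ S v S (play g S v p) ∂coinLaw P = M.welfare g S v := by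
  rw [(hg.integral_coalitionUtility v S S v).2, welfare]
  congr 1
  exact Finset.sum_congr rfl fun i hi => by simp [hi]

lemma Simulates.deviation_le_welfare (hg : M.Simulates g) (hglobal : M.GlobalSCP)
    (U F : Finset ℕ) (w : ℕ → ℝ≥0) :
    ∑ i ∈ F, ((if i ∈ U then (v i : ℝ) else 0) * M.allocProb g F i w - M.meanPayment g F i w)
        + M.meanRevenue g F w ≤ M.welfare g U v := by
  obtain ⟨hi, he⟩ := hg.integral_coalitionUtility (v := v) U F w
  rw [← he]
  refine integral_prod_le_of_expectation_le hi fun θ => ?_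
  have h := hglobal U v F fun s => g (w s) (θ s)
  rw [hg.execution_bidding, expectation_map (hg.measurable_play_right U v)
    (M.measurable_coalitionUtility U ∅ U v)] at h
  change _ ≤ expectation _ (fun p => M.coalitionUtility ∅ U v U (play g U v p)) at h
  rw [expectation_eq_integral (hg.integral_coalitionUtility v U U v).1,
    hg.integral_coalitionUtility_self] at h
  refine le_trans (le_of_eq ?_) h
  have hex : M.execution F (fun s => Measure.dirac (g (w s) (θ s))) =
      P.map (fun ω => play g F w (θ, ω)) := by
    rw [execution, ← Measure.infinitePi_eq_pi, Measure.infinitePi_dirac, Measure.dirac_prod]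
    rfl
  rw [hex, expectation_map (φ := fun ω => play g F w (θ, ω))
    ((hg.measurable_play_right F w).comp measurable_prodMk_left)
    (M.measurable_coalitionUtility F ∅ U v)]
  rfl

/-- The allocation probability of `i` is a subgradient of the welfare in the value of `i`. -/
lemma Simulates.welfare_subgradient (hg : M.Simulates g) (hglobal : M.GlobalSCP) {U : Finset ℕ}
    {i : ℕ} (hi : i ∈ U) (a b : ℝ≥0) :
    M.welfare g U (Function.update v i b) + ((a : ℝ) - b) *
        M.allocProb g U i (Function.update v i b) ≤
      M.welfare g U (Function.update v i a) := by
  refine le_trans (le_of_eq ?_) (hg.deviation_le_welfare (v := Function.update v i a) hglobal U U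
    (Function.update v i b))
  unfold welfare
  rw [← Finset.add_sum_erase U _ hi, ← Finset.add_sum_erase U _ hi]
  have : ∀ j ∈ U.erase i, (if j ∈ U then ((Function.update v i a j : ℝ≥0) : ℝ) else 0) *
      M.allocProb g U j (Function.update v i b) - M.meanPayment g U j (Function.update v i b) =
      ((Function.update v i b j : ℝ≥0) : ℝ) *
      M.allocProb g U j (Function.update v i b) - M.meanPayment g U j (Function.update v i b) := by
    intro j hj
    rw [Finset.mem_erase] at hj
    simp [hj.1, hj.2]
  rw [Finset.sum_congr rfl this]
  simp only [hi, if_true, Function.update_self]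
  ring

/-- A user without value contributes nothing to the welfare: the remaining users can post its bid as
a fake bid, and conversely its bid can be left out. -/
lemma Simulates.welfare_update_zero (hg : M.Simulates g) (hglobal : M.GlobalSCP) {H : Finset ℕ}
    {i : ℕ} (hi : i ∉ H) :
    M.welfare g (H ∪ {i}) (Function.update v i 0) = M.welfare g H v := by
  have hv : M.welfare g H v = M.welfare g H (Function.update v i 0) :=
    welfare_congr fun s hs => by
      rw [Function.update_of_ne]; rintro rfl; exact hi hs
  rw [hv]
  set w := Function.update v i 0 with hw
  have hwi : w i = 0 := by simp [hw]
  apply le_antisymm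
  · refine le_trans (le_of_eq ?_) (hg.deviation_le_welfare (v := w) hglobal H (H ∪ {i}) w)
    unfold welfare
    congr 1
    refine Finset.sum_congr rfl fun j hj => ?_
    by_cases hji : j = i
    · subst hji; simp [hi, hwi]
    · have : j ∈ H := by simpa [hji] using hj
      simp [this]
  · refine le_trans (le_of_eq ?_) (hg.deviation_le_welfare (v := w) hglobal (H ∪ {i}) H w)
    unfold welfare
    congr 1
    refine Finset.sum_congr rfl fun j hj => ?_
    simp [hj]

end Play

/-! ### Bayesian incentive compatibility in interim form -/

section Bayesian

variable {M : TFM P} {g : ℝ≥0 → unitInterval → ℝ} {D : Measure ℝ≥0} [IsProbabilityMeasure D]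

lemma Simulates.compProd_eq_map (hg : M.Simulates g) :
    D ⊗ₘ M.bidding = (D.prod volume).map (fun p => (p.1, g p.1 p.2)) := by
  have hm : Measurable fun p : ℝ≥0 × unitInterval => (p.1, g p.1 p.2) :=
    measurable_fst.prodMk hg.measurable
  ext s hs
  rw [Measure.compProd_apply hs, Measure.map_apply hm hs, Measure.prod_apply (hm hs)]
  refine lintegral_congr fun v => ?_
  have hv : Measurable (g v) := hg.measurable.comp measurable_prodMk_left
  rw [← hg.map_eq, Measure.map_apply hv (measurable_prodMk_left hs)]
  rfl

lemma Simulates.honestBid_eq_map (hg : M.Simulates g) :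
    M.honestBid D = (D.prod volume).map (fun p => g p.1 p.2) := by
  have hm : Measurable fun p : ℝ≥0 × unitInterval => (p.1, g p.1 p.2) :=
    measurable_fst.prodMk hg.measurable
  rw [honestBid, ← Measure.snd_compProd, hg.compProd_eq_map, Measure.snd,
    Measure.map_map measurable_snd hm]
  rfl

variable [IsProbabilityMeasure P]

variable (D) in
lemma execution_eq_map (S : Finset ℕ) {q : ℕ → Measure ℝ} {φ : ℕ → ℝ≥0 × unitInterval → ℝ}
    (hφ : ∀ s, Measurable (φ s)) (hq : ∀ s, q s = (D.prod volume).map (φ s)) :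
    M.execution S q = ((valueLaw D).prod (coinLaw P)).map
      (fun x => (fun s : S => φ s (x.1 s, x.2.1 s), x.2.2)) := by
  have hm : Measurable fun p : (ℕ → ℝ≥0) × (ℕ → unitInterval) =>
      fun s : S => φ s (p.1 s, p.2 s) :=
    measurable_pi_lambda _ fun s => (hφ s).comp (f := fun p : (ℕ → ℝ≥0) × (ℕ → unitInterval) =>
      (p.1 s, p.2 s)) (by fun_prop)
  rw [execution, valueLaw, coinLaw, ← Measure.prodAssoc_prod,
    Measure.map_map (by
      refine Measurable.prodMk (hm.comp (f := fun x : (ℕ → ℝ≥0) × ((ℕ → unitInterval) × Ω) =>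
        (x.1, x.2.1)) (by fun_prop)) (by fun_prop)) (by fun_prop)]
  simp only [hq]
  rw [← map_pi_prod_infinitePi D (volume : Measure unitInterval) S hφ]
  conv_lhs => rw [← Measure.map_id (μ := P)]
  rw [Measure.map_prod_map _ _ hm (by fun_prop)]
  rfl

lemma Simulates.execution_followingBids (hg : M.Simulates g) (S H : Finset ℕ) (v : ℕ → ℝ≥0) :
    M.execution S (M.followingBids D H v) = ((valueLaw D).prod (coinLaw P)).map
      (fun x => play g S (fun s => if s ∈ H then x.1 s else v s) x.2) := by
  have hm : Measurable fun p : ℝ≥0 × unitInterval => g p.1 p.2 := hg.measurable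
  have hm' : ∀ w, Measurable (g w) := fun w => hg.measurable.comp measurable_prodMk_left
  rw [execution_eq_map D S (φ := fun s p => g (if s ∈ H then p.1 else v s) p.2)]
  · rfl
  · intro s
    by_cases h : s ∈ H
    · simpa only [h, if_true] using hm
    · simp only [h, if_false]; exact (hm' (v s)).comp measurable_snd
  · intro s
    by_cases h : s ∈ H
    · simp only [followingBids, h, if_true, hg.honestBid_eq_map]
    · simp only [followingBids, h, if_false]
      change _ = (D.prod volume).map (g (v s) ∘ Prod.snd)
      rw [← Measure.map_map (hm' _) measurable_snd, ← Measure.snd, Measure.snd_prod, hg.map_eq]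

lemma Simulates.execution_deviatingBids (hg : M.Simulates g) (H : Finset ℕ) {i : ℕ} (hi : i ∉ H)
    (w : ℝ≥0) (t : unitInterval) :
    M.execution (H ∪ {i}) (M.deviatingBids D H fun _ => g w t) =
      ((valueLaw D).prod (coinLaw P)).map (fun x => play g (H ∪ {i}) (Function.update x.1 i w)
        (Function.update x.2.1 i t, x.2.2)) := by
  have hm : Measurable fun p : ℝ≥0 × unitInterval => g p.1 p.2 := hg.measurable
  rw [execution_eq_map D _ (φ := fun s p => if s ∈ H then g p.1 p.2 else g w t)]
  · congr 1
    funext x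
    simp only [play, Prod.mk.injEq, and_true]
    funext s
    by_cases h : (s : ℕ) ∈ H
    · have : (s : ℕ) ≠ i := by rintro h'; exact hi (h' ▸ h)
      simp [h, this]
    · have : (s : ℕ) = i := by simpa [h] using s.2
      simp [this, hi]
  · intro s
    by_cases h : s ∈ H
    · simpa only [h, if_true] using hm
    · simp only [h, if_false]; exact measurable_const
  · intro s
    by_cases h : s ∈ H
    · simp only [deviatingBids, h, if_true, hg.honestBid_eq_map]
    · simp [deviatingBids, h]

/-- Resampling the private coins of one identity does not change the law of all values and coins. -/
lemma measurePreserving_resample (i : ℕ) :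
    MeasurePreserving (fun q : unitInterval × ((ℕ → ℝ≥0) × ((ℕ → unitInterval) × Ω)) =>
      (q.2.1, (Function.update q.2.2.1 i q.1, q.2.2.2)))
      ((volume : Measure unitInterval).prod ((valueLaw D).prod (coinLaw P)))
      ((valueLaw D).prod (coinLaw P)) := by
  have h1 : MeasurePreserving (fun q : unitInterval × ((ℕ → unitInterval) × Ω) =>
      (Function.update q.2.1 i q.1, q.2.2)) ((volume : Measure unitInterval).prod (coinLaw P))
      (coinLaw P) :=
    ((measurePreserving_update_infinitePi (volume : Measure unitInterval) i).prod
      (MeasurePreserving.id P)).comp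
      ((measurePreserving_prodAssoc (volume : Measure unitInterval) _ P).symm _)
  exact ((MeasurePreserving.id (valueLaw D)).prod h1).comp
    ((measurePreserving_prodAssoc (valueLaw D) volume (coinLaw P)).comp
      (((Measure.measurePreserving_swap (μ := (volume : Measure unitInterval))
        (ν := valueLaw D)).prod (MeasurePreserving.id (coinLaw P))).comp
        ((measurePreserving_prodAssoc volume (valueLaw D) (coinLaw P)).symm _)))

/-- If no single bid of `i` against honest users in `H` makes `f` larger than `c` in expectation,
then neither does the random bid that the bidding rule prescribes for the value `w`. -/
lemma Simulates.integral_le_of_deviation (hg : M.Simulates g) {H : Finset ℕ} {i : ℕ} (hi : i ∉ H)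
    (w : ℝ≥0) {f : ((H ∪ {i} : Finset ℕ) → ℝ) × Ω → ℝ} (hf : Measurable f)
    (hint : Integrable (fun x => f (play g (H ∪ {i}) (Function.update x.1 i w) x.2))
      ((valueLaw D).prod (coinLaw P))) {c : ℝ}
    (hc : ∀ b, expectation (M.execution (H ∪ {i}) (M.deviatingBids D H b)) f ≤ (c : EReal)) :
    ∫ x, f (play g (H ∪ {i}) (Function.update x.1 i w) x.2) ∂((valueLaw D).prod (coinLaw P)) ≤ c := by
  have hT := measurePreserving_resample (D := D) (P := P) i
  have hI := hT.integrable_comp_of_integrable hint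
  rw [← hT.map_eq, integral_map hT.measurable.aemeasurable
    (by rw [hT.map_eq]; exact hint.aestronglyMeasurable)]
  refine integral_prod_le_of_expectation_le hI fun t => ?_
  have h := hc fun _ => g w t
  rw [hg.execution_deviatingBids H hi, expectation_map _ hf] at h
  · exact h
  · have hu : Measurable fun v : ℕ → ℝ≥0 => Function.update v i w := measurable_update_left
    have hu' : Measurable fun θ : ℕ → unitInterval => Function.update θ i t :=
      measurable_update_left
    exact (hg.measurable_play (H ∪ {i})).comp
      (f := fun x : (ℕ → ℝ≥0) × ((ℕ → unitInterval) × Ω) =>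
        (Function.update x.1 i w, (Function.update x.2.1 i t, x.2.2)))
      ((hu.comp measurable_fst).prodMk
        ((hu'.comp (measurable_fst.comp measurable_snd)).prodMk (by fun_prop)))

/-! ### Integrability -/

lemma integrable_value (hmean : ∫⁻ v, (v : ℝ≥0∞) ∂D < ∞) (s : ℕ) :
    Integrable (fun V : ℕ → ℝ≥0 => (V s : ℝ)) (valueLaw D) := by
  have h : Integrable (fun v : ℝ≥0 => (v : ℝ)) D := by
    refine ⟨by fun_prop, ?_⟩
    simpa [HasFiniteIntegral] using hmean
  exact (measurePreserving_eval_infinitePi (fun _ : ℕ => D) s).integrable_comp_of_integrable h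

variable (D) in
/-- A rule that turns the drawn values into values of finite mean; it is used for the drawn values
themselves and for the drawn values with one of them replaced. -/
structure IsIntegrableProfile (τ : (ℕ → ℝ≥0) → ℕ → ℝ≥0) : Prop where
  measurable : Measurable τ
  integrable : ∀ s, Integrable (fun V => (τ V s : ℝ)) (valueLaw D)

lemma isIntegrableProfile_id (hmean : ∫⁻ v, (v : ℝ≥0∞) ∂D < ∞) :
    IsIntegrableProfile D fun V => V :=
  ⟨measurable_id, integrable_value hmean⟩

lemma isIntegrableProfile_update (hmean : ∫⁻ v, (v : ℝ≥0∞) ∂D < ∞) (i : ℕ) (w : ℝ≥0) :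
    IsIntegrableProfile D fun V => Function.update V i w := by
  refine ⟨measurable_update_left, fun s => ?_⟩
  by_cases h : s = i
  · subst h; simp
  · simpa [Function.update_of_ne h] using integrable_value hmean s

variable {τ : (ℕ → ℝ≥0) → ℕ → ℝ≥0} (S : Finset ℕ) (i : ℕ)

lemma Simulates.measurable_play_comp {Ω : Type*} [MeasurableSpace Ω] {P : Measure Ω} {M : TFM P}
    (hg : M.Simulates g) (hτ : Measurable τ) :
    Measurable fun x : (ℕ → ℝ≥0) × ((ℕ → unitInterval) × Ω) => play g S (τ x.1) x.2 :=
  (hg.measurable_play S).comp (f := fun x : (ℕ → ℝ≥0) × ((ℕ → unitInterval) × Ω) => (τ x.1, x.2))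
    (by fun_prop)

lemma Simulates.integrable_confirmedAt_prod (hg : M.Simulates g) (hτ : IsIntegrableProfile D τ) :
    Integrable (fun x => M.confirmedAt S (play g S (τ x.1) x.2) i)
      ((valueLaw D).prod (coinLaw P)) :=
  integrable_prod_of_nonneg_of_le
    ((M.measurable_confirmedAt S i).comp (hg.measurable_play_comp S hτ.measurable))
    (fun _ => M.confirmedAt_nonneg S _ i) (fun V => hg.integrable_confirmedAt S i (τ V))
    (integrable_const 1) fun V => hg.allocProb_le_one S i (τ V)

lemma Simulates.integrable_paymentAt_prod (hg : M.Simulates g) (hτ : IsIntegrableProfile D τ) :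
    Integrable (fun x => M.paymentAt S (play g S (τ x.1) x.2) i)
      ((valueLaw D).prod (coinLaw P)) :=
  integrable_prod_of_nonneg_of_le
    ((M.measurable_paymentAt S i).comp (hg.measurable_play_comp S hτ.measurable))
    (fun _ => M.paymentAt_nonneg S _ i) (fun V => hg.integrable_paymentAt S i (τ V))
    (hτ.integrable i) fun V => (hg.meanPayment_le S i (τ V)).trans
      (mul_le_of_le_one_right (by positivity) (hg.allocProb_le_one S i (τ V)))

lemma Simulates.integrable_revenueAt_prod (hg : M.Simulates g) (hτ : IsIntegrableProfile D τ) :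
    Integrable (fun x => M.revenueAt S (play g S (τ x.1) x.2))
      ((valueLaw D).prod (coinLaw P)) :=
  integrable_prod_of_nonneg_of_le
    ((M.measurable_revenueAt S).comp (hg.measurable_play_comp S hτ.measurable))
    (fun _ => M.revenueAt_nonneg S _) (fun V => hg.integrable_revenueAt S (τ V))
    (integrable_finsetSum S fun i _ => hτ.integrable i) fun V => (hg.meanRevenue_le S (τ V)).trans
      (Finset.sum_le_sum fun i _ => (hg.meanPayment_le S i (τ V)).trans
        (mul_le_of_le_one_right (by positivity) (hg.allocProb_le_one S i (τ V))))

lemma Simulates.integrable_allocProb (hg : M.Simulates g) (hτ : IsIntegrableProfile D τ) :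
    Integrable (fun V => M.allocProb g S i (τ V)) (valueLaw D) :=
  (hg.integrable_confirmedAt_prod S i hτ).integral_prod_left

lemma Simulates.integrable_value_mul_allocProb (hg : M.Simulates g) (hτ : IsIntegrableProfile D τ) :
    Integrable (fun V => (τ V i : ℝ) * M.allocProb g S i (τ V)) (valueLaw D) := by
  refine (hτ.integrable i).mono' (Measurable.aestronglyMeasurable ?_) (.of_forall fun V => ?_)
  · exact Measurable.mul (((measurable_pi_apply i).comp hτ.measurable).coe_nnreal_real)
      ((hg.measurable_allocProb S i).comp hτ.measurable)
  · rw [Real.norm_of_nonneg (mul_nonneg (by positivity) (M.allocProb_nonneg g S i _))]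
    exact mul_le_of_le_one_right (by positivity) (hg.allocProb_le_one S i (τ V))

lemma Simulates.integrable_meanPayment (hg : M.Simulates g) (hτ : IsIntegrableProfile D τ) :
    Integrable (fun V => M.meanPayment g S i (τ V)) (valueLaw D) :=
  (hg.integrable_paymentAt_prod S i hτ).integral_prod_left

lemma Simulates.integrable_meanRevenue (hg : M.Simulates g) (hτ : IsIntegrableProfile D τ) :
    Integrable (fun V => M.meanRevenue g S (τ V)) (valueLaw D) :=
  (hg.integrable_revenueAt_prod S hτ).integral_prod_left

lemma Simulates.integrable_welfare (hg : M.Simulates g) (hτ : IsIntegrableProfile D τ) :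
    Integrable (fun V => M.welfare g S (τ V)) (valueLaw D) :=
  (integrable_finsetSum S fun i _ => (hg.integrable_value_mul_allocProb S i hτ).sub
    (hg.integrable_meanPayment S i hτ)).add (hg.integrable_meanRevenue S hτ)

/-- The expectation of a linear combination of confirmation, payment and revenue, over the values and
all coins, in terms of the interim quantities. -/
lemma Simulates.integral_utility (hg : M.Simulates g) (hτ : IsIntegrableProfile D τ) (a b : ℝ) :
    Integrable (fun x => a * M.confirmedAt S (play g S (τ x.1) x.2) i -
        M.paymentAt S (play g S (τ x.1) x.2) i + b * M.revenueAt S (play g S (τ x.1) x.2))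
      ((valueLaw D).prod (coinLaw P)) ∧
    ∫ x, (a * M.confirmedAt S (play g S (τ x.1) x.2) i -
        M.paymentAt S (play g S (τ x.1) x.2) i + b * M.revenueAt S (play g S (τ x.1) x.2))
      ∂((valueLaw D).prod (coinLaw P)) =
    a * ∫ V, M.allocProb g S i (τ V) ∂valueLaw D - ∫ V, M.meanPayment g S i (τ V) ∂valueLaw D
      + b * ∫ V, M.meanRevenue g S (τ V) ∂valueLaw D := by
  have h1 := hg.integrable_confirmedAt_prod S i hτ
  have h2 := hg.integrable_paymentAt_prod S i hτ
  have h3 := hg.integrable_revenueAt_prod S hτ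
  refine ⟨((h1.const_mul a).sub h2).add (h3.const_mul b), ?_⟩
  have h12 : Integrable (fun x => a * M.confirmedAt S (play g S (τ x.1) x.2) i -
      M.paymentAt S (play g S (τ x.1) x.2) i) ((valueLaw D).prod (coinLaw P)) :=
    (h1.const_mul a).sub h2
  rw [integral_add h12 (h3.const_mul b), integral_sub (h1.const_mul a) h2,
    integral_const_mul, integral_const_mul, integral_prod _ h1, integral_prod _ h2,
    integral_prod _ h3]
  rfl

end Bayesian

/-! ### Interim incentive constraints -/

section Interim

variable (M : TFM P) (g : ℝ≥0 → unitInterval → ℝ) (D : Measure ℝ≥0) [IsProbabilityMeasure D]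
  (H : Finset ℕ) (i : ℕ) (w : ℝ≥0)

/-- The probability that `i` is confirmed if it bids as a user with value `w` against honest users in
`H` with values drawn from `D`. -/
noncomputable def interimAlloc : ℝ :=
  ∫ V, M.allocProb g (H ∪ {i}) i (Function.update V i w) ∂valueLaw D

/-- The expected payment of `i` if it bids as a user with value `w` against honest users in `H` with
values drawn from `D`. -/
noncomputable def interimPayment : ℝ :=
  ∫ V, M.meanPayment g (H ∪ {i}) i (Function.update V i w) ∂valueLaw D

/-- The expected revenue if `i` bids as a user with value `w` and the users in `H` are honest with
values drawn from `D`. -/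
noncomputable def interimRevenue : ℝ :=
  ∫ V, M.meanRevenue g (H ∪ {i}) (Function.update V i w) ∂valueLaw D

/-- The expected welfare if `i` has value `w` and the users in `H` have values drawn from `D`. -/
noncomputable def interimWelfare : ℝ :=
  ∫ V, M.welfare g (H ∪ {i}) (Function.update V i w) ∂valueLaw D

/-- The expected revenue of an honest execution with values drawn from `D`. -/
noncomputable def expectedRevenue (S : Finset ℕ) : ℝ := ∫ V, M.meanRevenue g S V ∂valueLaw D

/-- The expected welfare of an honest execution with values drawn from `D`. -/
noncomputable def expectedWelfare (S : Finset ℕ) : ℝ := ∫ V, M.welfare g S V ∂valueLaw D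

variable {M g D H i}
variable [IsProbabilityMeasure P]

/-- Honest behaviour of `i` with value `v` and of `H` with values from `D`, on the common probability
space. -/
lemma Simulates.execution_followingBids_union (hg : M.Simulates g) (hi : i ∉ H) (v : ℕ → ℝ≥0) :
    M.execution (H ∪ {i}) (M.followingBids D H v) = ((valueLaw D).prod (coinLaw P)).map
      (fun x => play g (H ∪ {i}) (Function.update x.1 i (v i)) x.2) := by
  rw [hg.execution_followingBids]
  congr 1
  funext x
  rw [play_congr]
  intro s hs
  by_cases h : s = i
  · subst h; simp [hi]
  · have : s ∈ H := by simpa [h] using hs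
    simp [this, h]

/-- If every fixed bid of `i` against honest users in `H` yields at most `c`, then so does the bid that
the bidding rule prescribes for the value `w`. Here `f` is a linear combination of the outcome for `i`
and the revenue, which covers the utilities of a user, of the miner, and of both together. -/
lemma Simulates.interim_utility_le (hg : M.Simulates g) (hmean : ∫⁻ v, (v : ℝ≥0∞) ∂D < ∞)
    (hi : i ∉ H) {f : ((H ∪ {i} : Finset ℕ) → ℝ) × Ω → ℝ} {a b c : ℝ}
    (hf : ∀ z, f z = a * M.confirmedAt (H ∪ {i}) z i - M.paymentAt (H ∪ {i}) z i
      + b * M.revenueAt (H ∪ {i}) z)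
    (hc : ∀ bid, expectation (M.execution (H ∪ {i}) (M.deviatingBids D H bid)) f ≤ (c : EReal)) :
    a * M.interimAlloc g D H i w - M.interimPayment g D H i w + b * M.interimRevenue g D H i w
      ≤ c := by
  obtain ⟨h1, h2⟩ := hg.integral_utility (H ∪ {i}) i (isIntegrableProfile_update hmean i w) a b
  have hfm : Measurable f := by
    rw [funext hf]
    exact (((M.measurable_confirmedAt _ i).const_mul _).sub (M.measurable_paymentAt _ i)).add
      ((M.measurable_revenueAt _).const_mul _)
  have h := hg.integral_le_of_deviation hi w hfm (by simpa only [hf] using h1) hc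
  simp only [hf] at h
  exact h2.symm.le.trans h

lemma Simulates.expectation_followingBids (hg : M.Simulates g)
    (hmean : ∫⁻ v, (v : ℝ≥0∞) ∂D < ∞)
    (hi : i ∉ H) (v : ℕ → ℝ≥0) {f : ((H ∪ {i} : Finset ℕ) → ℝ) × Ω → ℝ} {a b : ℝ}
    (hf : ∀ z, f z = a * M.confirmedAt (H ∪ {i}) z i - M.paymentAt (H ∪ {i}) z i
      + b * M.revenueAt (H ∪ {i}) z) :
    expectation (M.execution (H ∪ {i}) (M.followingBids D H v)) f =
      ((a * M.interimAlloc g D H i (v i) - M.interimPayment g D H i (v i)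
        + b * M.interimRevenue g D H i (v i) : ℝ) : EReal) := by
  have hτ := isIntegrableProfile_update hmean i (v i)
  obtain ⟨h1, h2⟩ := hg.integral_utility (H ∪ {i}) i hτ a b
  have hfm : Measurable f := by
    rw [funext hf]
    exact (((M.measurable_confirmedAt _ i).const_mul _).sub (M.measurable_paymentAt _ i)).add
      ((M.measurable_revenueAt _).const_mul _)
  rw [hg.execution_followingBids_union hi,
    expectation_map (hg.measurable_play_comp _ hτ.measurable) hfm]
  simp only [Function.comp_def, hf]
  rw [expectation_eq_integral h1, h2]
  rfl

lemma Simulates.interim_uic (hg : M.Simulates g) (hmean : ∫⁻ v, (v : ℝ≥0∞) ∂D < ∞)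
    (huic : M.BayesianUIC D) (hi : i ∉ H) (v w : ℝ≥0) :
    v * M.interimAlloc g D H i w - M.interimPayment g D H i w ≤
      v * M.interimAlloc g D H i v - M.interimPayment g D H i v := by
  have hf : ∀ z, M.userUtility H {i} (fun _ => v) (H ∪ {i}) z =
      v * M.confirmedAt (H ∪ {i}) z i - M.paymentAt (H ∪ {i}) z i
        + 0 * M.revenueAt (H ∪ {i}) z := fun z => by
    rw [M.userUtility_union_singleton hi]; simp
  have := hg.interim_utility_le w hmean hi hf fun bid =>
    (huic H i hi (fun _ => v) {i} (by simpa using hi) bid).trans_eq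
      (hg.expectation_followingBids hmean hi (fun _ => v) hf)
  simpa using this

lemma Simulates.interim_scp (hg : M.Simulates g) (hmean : ∫⁻ v, (v : ℝ≥0∞) ∂D < ∞)
    (hscp : M.BayesianSCP D 1) (hi : i ∉ H) (v w : ℝ≥0) :
    v * M.interimAlloc g D H i w - M.interimPayment g D H i w + M.interimRevenue g D H i w ≤
      v * M.interimAlloc g D H i v - M.interimPayment g D H i v + M.interimRevenue g D H i v := by
  have hf : ∀ z, M.coalitionUtility H {i} (fun _ => v) (H ∪ {i}) z =
      v * M.confirmedAt (H ∪ {i}) z i - M.paymentAt (H ∪ {i}) z i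
        + 1 * M.revenueAt (H ∪ {i}) z := fun z => by
    rw [coalitionUtility, M.userUtility_union_singleton hi]; simp [revenueAt]
  have := hg.interim_utility_le w hmean hi hf fun bid =>
    (hscp {i} (by simp) H (by simpa using hi) (fun _ => v) H subset_rfl {i} (by simpa using hi)
      bid).trans_eq (hg.expectation_followingBids hmean hi (fun _ => v) hf)
  simpa using this

lemma Simulates.interimPayment_zero (hg : M.Simulates g) : M.interimPayment g D H i 0 = 0 := by
  unfold interimPayment
  refine integral_eq_zero_of_ae (.of_forall fun V => le_antisymm ?_ (M.meanPayment_nonneg _ _ _ _))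
  simpa using hg.meanPayment_le (H ∪ {i}) i (Function.update V i 0)

/-- The miner can post the bid of a user without value as a fake bid, which is free of charge. -/
lemma Simulates.interim_mic (hg : M.Simulates g) (hmean : ∫⁻ v, (v : ℝ≥0∞) ∂D < ∞)
    (hmic : M.BayesianMIC D) (hi : i ∉ H) :
    M.interimRevenue g D H i 0 ≤ M.expectedRevenue g D H := by
  have hf : ∀ z, M.coalitionUtility H ∅ (fun _ => 0) (H ∪ {i}) z =
      0 * M.confirmedAt (H ∪ {i}) z i - M.paymentAt (H ∪ {i}) z i
        + 1 * M.revenueAt (H ∪ {i}) z := fun z => by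
    rw [coalitionUtility, M.userUtility_union_singleton hi]; simp [revenueAt]
  have hτ := isIntegrableProfile_id hmean
  have hfol : expectation (M.execution (H ∪ ∅) (M.followingBids D H fun _ => 0))
      (M.coalitionUtility H ∅ (fun _ => 0) (H ∪ ∅)) = ((M.expectedRevenue g D H : ℝ) : EReal) := by
    rw [Finset.union_empty]
    have he : M.coalitionUtility H ∅ (fun _ => 0) H = M.revenueAt H := by
      funext z
      rw [coalitionUtility, userUtility_eq, Finset.sum_eq_zero fun s hs => by simp [hs]]
      simp [revenueAt]
    have hex : M.execution H (M.followingBids D H fun _ => 0) =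
        ((valueLaw D).prod (coinLaw P)).map
          (fun x : (ℕ → ℝ≥0) × ((ℕ → unitInterval) × Ω) => play g H x.1 x.2) := by
      rw [hg.execution_followingBids]
      congr 1
      funext x
      rw [play_congr]
      intro s hs
      simp [hs]
    rw [he, hex, expectation_map (hg.measurable_play H) (M.measurable_revenueAt H)]
    change expectation _ (fun x : (ℕ → ℝ≥0) × ((ℕ → unitInterval) × Ω) =>
      M.revenueAt H (play g H x.1 x.2)) = _
    rw [expectation_eq_integral (hg.integrable_revenueAt_prod H hτ),
      integral_prod _ (hg.integrable_revenueAt_prod H hτ)]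
    rfl
  have := hg.interim_utility_le 0 hmean hi hf fun bid =>
    (hmic H (by simp) (fun _ => 0) H subset_rfl {i} (by simpa using hi) bid).trans_eq hfol
  simpa [hg.interimPayment_zero] using this

lemma Simulates.interimWelfare_subgradient (hg : M.Simulates g)
    (hmean : ∫⁻ v, (v : ℝ≥0∞) ∂D < ∞) (hglobal : M.GlobalSCP) (v w : ℝ≥0) :
    M.interimWelfare g D H i w + ((v : ℝ) - w) * M.interimAlloc g D H i w ≤
      M.interimWelfare g D H i v := by
  have hw := isIntegrableProfile_update hmean i w
  have hv := isIntegrableProfile_update hmean i v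
  unfold interimWelfare interimAlloc
  rw [← integral_const_mul, ← integral_add (hg.integrable_welfare _ hw)
    ((hg.integrable_allocProb _ i hw).const_mul _)]
  exact integral_mono ((hg.integrable_welfare _ hw).add
    ((hg.integrable_allocProb _ i hw).const_mul _)) (hg.integrable_welfare _ hv)
    fun V => hg.welfare_subgradient V hglobal (by simp) v w

lemma Simulates.interimWelfare_zero (hg : M.Simulates g) (hglobal : M.GlobalSCP) (hi : i ∉ H) :
    M.interimWelfare g D H i 0 = M.expectedWelfare g D H := by
  unfold interimWelfare expectedWelfare
  exact integral_congr_ae (.of_forall fun V => hg.welfare_update_zero V hglobal hi)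

/-! ### Vanishing revenue and additivity of the welfare -/

/-- Replacing the value of `i` by an independent draw from `D` does not change expectations. -/
lemma integral_update {F : (ℕ → ℝ≥0) → ℝ} (hF : Integrable F (valueLaw D)) (i : ℕ) :
    ∫ w, ∫ V, F (Function.update V i w) ∂valueLaw D ∂D = ∫ V, F V ∂valueLaw D := by
  have h := measurePreserving_update_infinitePi D i
  change MeasurePreserving _ (D.prod (valueLaw D)) (valueLaw D) at h
  conv_rhs => rw [← h.map_eq]
  rw [integral_map h.measurable.aemeasurable (by rw [h.map_eq]; exact hF.aestronglyMeasurable),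
    integral_prod (fun q : ℝ≥0 × (ℕ → ℝ≥0) => F (Function.update q.2 i q.1))
      (h.integrable_comp_of_integrable hF)]

/-- The utility of `i` and its joint utility with the miner have a common subgradient in the value of
`i`, so the revenue cannot depend on it. -/
lemma Simulates.interimRevenue_eq (hg : M.Simulates g) (hmean : ∫⁻ v, (v : ℝ≥0∞) ∂D < ∞)
    (huic : M.BayesianUIC D) (hscp : M.BayesianSCP D 1) (hi : i ∉ H) :
    M.interimRevenue g D H i w = M.interimRevenue g D H i 0 := by
  have := sub_eq_sub_of_common_subgradient
    (f := fun v => v * M.interimAlloc g D H i v - M.interimPayment g D H i v)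
    (h := fun v => v * M.interimAlloc g D H i v - M.interimPayment g D H i v
      + M.interimRevenue g D H i v) (x := M.interimAlloc g D H i)
    (fun a b => by linarith [hg.interim_uic hmean huic hi a b])
    (fun a b => by linarith [hg.interim_scp hmean hscp hi a b]) w
  linarith

/-- The utility of `i` and the welfare have a common subgradient in the value of `i`: in expectation,
each user receives its marginal contribution to the welfare. -/
lemma Simulates.interim_utility_eq (hg : M.Simulates g) (hmean : ∫⁻ v, (v : ℝ≥0∞) ∂D < ∞)
    (huic : M.BayesianUIC D) (hglobal : M.GlobalSCP) (hi : i ∉ H) :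
    w * M.interimAlloc g D H i w - M.interimPayment g D H i w =
      M.interimWelfare g D H i w - M.expectedWelfare g D H := by
  have := sub_eq_sub_of_common_subgradient
    (f := fun v => v * M.interimAlloc g D H i v - M.interimPayment g D H i v)
    (h := M.interimWelfare g D H i) (x := M.interimAlloc g D H i)
    (fun a b => by linarith [hg.interim_uic hmean huic hi a b])
    (fun a b => hg.interimWelfare_subgradient hmean hglobal a b) w
  rw [hg.interimWelfare_zero hglobal hi] at this
  simpa [hg.interimPayment_zero] using this

lemma Simulates.expectedRevenue_eq_zero (hg : M.Simulates g) (hmean : ∫⁻ v, (v : ℝ≥0∞) ∂D < ∞)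
    (huic : M.BayesianUIC D) (hmic : M.BayesianMIC D) (hscp : M.BayesianSCP D 1) (S : Finset ℕ) :
    M.expectedRevenue g D S = 0 := by
  refine le_antisymm ?_ (integral_nonneg fun V => M.meanRevenue_nonneg g S V)
  induction S using Finset.induction_on with
  | empty =>
    refine integral_nonpos fun V => ?_
    simpa using hg.meanRevenue_le ∅ V
  | insert i H hi ih =>
    refine le_trans (le_of_eq ?_) ((hg.interim_mic hmean hmic hi).trans ih)
    rw [Finset.insert_eq, Finset.union_comm, expectedRevenue,
      ← integral_update (hg.integrable_meanRevenue _ (isIntegrableProfile_id hmean)) i]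
    change ∫ w, M.interimRevenue g D H i w ∂D = _
    simp_rw [hg.interimRevenue_eq _ hmean huic hscp hi]
    simp

/-- The expected utility of a user is its expected marginal contribution to the welfare. -/
lemma Simulates.integral_utility_eq_marginal (hg : M.Simulates g)
    (hmean : ∫⁻ v, (v : ℝ≥0∞) ∂D < ∞)
    (huic : M.BayesianUIC D) (hglobal : M.GlobalSCP) {U : Finset ℕ} (hi : i ∈ U) :
    ∫ V, ((V i : ℝ) * M.allocProb g U i V - M.meanPayment g U i V) ∂valueLaw D =
      M.expectedWelfare g D U - M.expectedWelfare g D (U.erase i) := by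
  have hid := isIntegrableProfile_id hmean
  obtain ⟨H, hiH, rfl⟩ : ∃ H, i ∉ H ∧ H ∪ {i} = U :=
    ⟨U.erase i, by simp, by rw [Finset.union_comm, ← Finset.insert_eq, Finset.insert_erase hi]⟩
  have he : (H ∪ {i}).erase i = H := by
    rw [Finset.union_comm, ← Finset.insert_eq, Finset.erase_insert hiH]
  have hint := hg.integrable_welfare (H ∪ {i}) hid
  have hint' := (measurePreserving_update_infinitePi D i).integrable_comp_of_integrable hint
  have hW : Integrable (fun w => M.interimWelfare g D H i w) D := hint'.integral_prod_left
  have hu : Integrable (fun V : ℕ → ℝ≥0 => (V i : ℝ) * M.allocProb g (H ∪ {i}) i V -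
      M.meanPayment g (H ∪ {i}) i V) (valueLaw D) :=
    (hg.integrable_value_mul_allocProb _ i hid).sub (hg.integrable_meanPayment _ i hid)
  rw [he, ← integral_update hu i]
  have : ∀ w, ∫ V, ((Function.update V i w i : ℝ≥0) : ℝ) *
      M.allocProb g (H ∪ {i}) i (Function.update V i w) -
      M.meanPayment g (H ∪ {i}) i (Function.update V i w) ∂valueLaw D =
      M.interimWelfare g D H i w - M.expectedWelfare g D H := by
    intro w
    have hw := isIntegrableProfile_update hmean i w
    rw [← hg.interim_utility_eq w hmean huic hglobal hiH]
    simp only [Function.update_self]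
    rw [integral_sub ((hg.integrable_allocProb _ i hw).const_mul _)
      (hg.integrable_meanPayment _ i hw), integral_const_mul]
    rfl
  simp only [this]
  rw [integral_sub hW (integrable_const _)]
  simp only [integral_const, probReal_univ, one_smul]
  congr 1
  exact integral_update hint i

/-- The users' utilities add up to the welfare since there is no revenue. -/
lemma Simulates.expectedWelfare_eq_sum_marginal (hg : M.Simulates g)
    (hmean : ∫⁻ v, (v : ℝ≥0∞) ∂D < ∞)
    (huic : M.BayesianUIC D) (hmic : M.BayesianMIC D) (hscp : M.BayesianSCP D 1)
    (hglobal : M.GlobalSCP) (U : Finset ℕ) :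
    M.expectedWelfare g D U =
      ∑ i ∈ U, (M.expectedWelfare g D U - M.expectedWelfare g D (U.erase i)) := by
  have hid := isIntegrableProfile_id hmean
  have hi : ∀ i ∈ U, Integrable (fun V : ℕ → ℝ≥0 => (V i : ℝ) * M.allocProb g U i V -
      M.meanPayment g U i V) (valueLaw D) := fun i _ =>
    (hg.integrable_value_mul_allocProb _ i hid).sub (hg.integrable_meanPayment _ i hid)
  rw [← Finset.sum_congr rfl fun i hi =>
    hg.integral_utility_eq_marginal hmean huic hglobal hi, ← integral_finsetSum _ hi]
  have h0 := hg.expectedRevenue_eq_zero hmean huic hmic hscp U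
  unfold expectedRevenue at h0
  unfold expectedWelfare welfare
  rw [integral_add (integrable_finsetSum _ hi) (hg.integrable_meanRevenue U hid), h0, add_zero]

/-- Solving the recursion for the expected welfare: it is additive over the users. -/
lemma Simulates.expectedWelfare_eq_sum (hg : M.Simulates g)
    (hmean : ∫⁻ v, (v : ℝ≥0∞) ∂D < ∞)
    (huic : M.BayesianUIC D) (hmic : M.BayesianMIC D) (hscp : M.BayesianSCP D 1)
    (hglobal : M.GlobalSCP) (U : Finset ℕ) :
    M.expectedWelfare g D U = ∑ i ∈ U, M.expectedWelfare g D {i} := by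
  induction U using Finset.strongInduction with
  | H U ih =>
    have h := hg.expectedWelfare_eq_sum_marginal hmean huic hmic hscp hglobal U
    rw [Finset.sum_sub_distrib, Finset.sum_const, nsmul_eq_mul] at h
    have h1 : ∀ i ∈ U, M.expectedWelfare g D (U.erase i) =
        ∑ j ∈ U, M.expectedWelfare g D {j} - M.expectedWelfare g D {i} := fun i hi => by
      rw [ih _ (Finset.erase_ssubset hi), ← Finset.add_sum_erase U _ hi]; ring
    rw [Finset.sum_congr rfl h1, Finset.sum_sub_distrib, Finset.sum_const, nsmul_eq_mul] at h
    -- The recursion determines the welfare unless there is exactly one user.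
    by_cases hc : U.card = 1
    · obtain ⟨i, rfl⟩ := Finset.card_eq_one.1 hc
      simp
    · have hc' : (U.card : ℝ) - 1 ≠ 0 := sub_ne_zero.2 (by exact_mod_cast hc)
      apply mul_left_cancel₀ hc'
      linarith

/-! ### Weak symmetry and the block size -/

lemma Simulates.expectedWelfare_nonneg (hg : M.Simulates g) (U : Finset ℕ) :
    0 ≤ M.expectedWelfare g D U :=
  integral_nonneg fun V => hg.welfare_nonneg U V

/-- At most `k` users are confirmed, each of which is worth at most `K` plus the excess of its value
over `K`. -/
lemma Simulates.expectedWelfare_le (hg : M.Simulates g) (hmean : ∫⁻ v, (v : ℝ≥0∞) ∂D < ∞) {k : ℕ}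
    (hM : M.BlockSizeAtMost k) (U : Finset ℕ) (K : ℝ≥0) :
    M.expectedWelfare g D U ≤ k * K + U.card * ∫ v, ((v - K : ℝ≥0) : ℝ) ∂D := by
  have hid := isIntegrableProfile_id hmean
  have hex : ∀ s, Integrable (fun V : ℕ → ℝ≥0 => ((V s - K : ℝ≥0) : ℝ)) (valueLaw D) := fun s =>
    (hid.integrable s).mono' (Measurable.aestronglyMeasurable (by fun_prop))
      (.of_forall fun V => by
        rw [Real.norm_of_nonneg (by positivity)]
        exact_mod_cast tsub_le_self)
  have hev : ∀ s, ∫ V : ℕ → ℝ≥0, ((V s - K : ℝ≥0) : ℝ) ∂valueLaw D =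
      ∫ v, ((v - K : ℝ≥0) : ℝ) ∂D := fun s => by
    have hp := measurePreserving_eval_infinitePi (fun _ : ℕ => D) s
    conv_rhs => rw [← hp.map_eq]
    rw [integral_map hp.measurable.aemeasurable (Measurable.aestronglyMeasurable (by fun_prop))]
    rfl
  calc M.expectedWelfare g D U
      ≤ ∫ V : ℕ → ℝ≥0, ((k : ℝ) * K + ∑ s ∈ U, ((V s - K : ℝ≥0) : ℝ)) ∂valueLaw D := by
        refine integral_mono (hg.integrable_welfare U hid)
          ((integrable_const _).add (integrable_finsetSum _ fun s _ => hex s)) fun V => ?_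
        refine (hg.welfare_le U V).trans ?_
        calc ∑ i ∈ U, (V i : ℝ) * M.allocProb g U i V
            ≤ ∑ i ∈ U, ((K : ℝ) * M.allocProb g U i V + ((V i - K : ℝ≥0) : ℝ)) := by
              refine Finset.sum_le_sum fun i _ => ?_
              have h1 : (V i : ℝ) ≤ K + ((V i - K : ℝ≥0) : ℝ) := by
                exact_mod_cast le_add_tsub
              have h2 := mul_le_mul_of_nonneg_right h1 (M.allocProb_nonneg g U i V)
              have h3 := mul_le_of_le_one_right (NNReal.coe_nonneg (V i - K))
                (hg.allocProb_le_one U i V)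
              linarith
          _ ≤ _ := by
              rw [Finset.sum_add_distrib, ← Finset.mul_sum, mul_comm (k : ℝ)]
              have := mul_le_mul_of_nonneg_left (hg.sum_allocProb_le U V hM) K.coe_nonneg
              linarith
    _ = _ := by
        rw [integral_add (integrable_const _) (integrable_finsetSum _ fun s _ => hex s),
          integral_finsetSum _ fun s _ => hex s]
        simp [hev]

/-- By weak symmetry, a single user has the same welfare under all identities. -/
lemma Simulates.expectedWelfare_singleton_eq (hg : M.Simulates g) (hsymm : M.IsWeaklySymmetric)
    (i j : ℕ) : M.expectedWelfare g D {i} = M.expectedWelfare g D {j} := by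
  -- The expected welfare from a single user with value `v` who bids `x` under the identity `i`.
  let h : ℕ → ℝ≥0 → ℝ → ℝ := fun i v x =>
    ∫ ω, M.coalitionUtility ∅ {i} (fun _ => v) {i} (fun _ => x, ω) ∂P
  have hh : ∀ v x, h i v x = h j v x := by
    intro v x
    let X : ℕ → Ω → ℝ × Bool × ℝ := fun i ω =>
      (M.revenue {i} (fun _ => x) ω, M.confirmed {i} (fun _ => x) ω ⟨i, by simp⟩,
        M.payment {i} (fun _ => x) ω ⟨i, by simp⟩)
    have hX : ∀ i, Measurable (X i) := fun i =>
      ((M.measurable_revenue {i}).comp measurable_prodMk_left).prodMk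
        (((M.measurable_confirmed {i} _).comp measurable_prodMk_left).prodMk
          ((M.measurable_payment {i} _).comp measurable_prodMk_left))
    have hlaw : P.map (X i) = P.map (X j) := by
      ext B hB
      rw [Measure.map_apply (hX i) hB, Measure.map_apply (hX j) hB]
      let e : ({i} : Finset ℕ) ≃ ({j} : Finset ℕ) := Equiv.ofUnique _ _
      let A : Set (ℝ × (({j} : Finset ℕ) → ℝ × Bool × ℝ)) :=
        {y | (y.1, (y.2 ⟨j, by simp⟩).2) ∈ B}
      have hA : MeasurableSet A := by
        refine measurableSet_preimage (f := fun y : ℝ × (({j} : Finset ℕ) → ℝ × Bool × ℝ) =>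
          (y.1, (y.2 ⟨j, by simp⟩).2)) (by fun_prop) hB
      refine hsymm {i} {j} e (fun _ => x) A hA fun π r o ho => ?_
      rwa [Subsingleton.elim π 1]
    let F : ℝ × Bool × ℝ → ℝ := fun y => (if y.2.1 = true then (v : ℝ) else 0) - y.2.2 + y.1
    have hF : Measurable F := by
      refine Measurable.add (Measurable.sub (Measurable.ite ?_ measurable_const measurable_const)
        (by fun_prop)) (by fun_prop)
      exact measurableSet_eq_fun (by fun_prop) measurable_const
    have hhF : ∀ i, h i v x = ∫ ω, F (X i ω) ∂P := fun i => by
      refine integral_congr_ae (.of_forall fun ω => ?_)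
      simp [coalitionUtility, userUtility, F, X]
      rfl
    rw [hhF, hhF, ← integral_map (hX i).aemeasurable hF.aestronglyMeasurable, hlaw,
      integral_map (hX j).aemeasurable hF.aestronglyMeasurable]
  -- The welfare of `i` alone depends on its value only, and in the same way for all identities.
  have hw : ∀ i V, M.welfare g {i} V = ∫ t : unitInterval, h i (V i) (g (V i) t) := by
    intro i V
    have hm : Measurable fun q : unitInterval × Ω =>
        M.coalitionUtility ∅ {i} (fun _ => V i) {i} ((fun _ => g (V i) q.1), q.2) := by
      refine (M.measurable_coalitionUtility {i} ∅ {i} _).comp (f := fun q : unitInterval × Ω =>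
        ((fun _ => g (V i) q.1, q.2) : (({i} : Finset ℕ) → ℝ) × Ω))
        (Measurable.prodMk (measurable_pi_lambda _ fun _ => ?_) measurable_snd)
      exact (hg.measurable.comp measurable_prodMk_left).comp measurable_fst
    have hp := measurePreserving_eval_infinitePi (fun _ : ℕ => (volume : Measure unitInterval)) i
    have hV : M.welfare g {i} V = M.welfare g {i} fun _ => V i :=
      welfare_congr fun s hs => by rw [Finset.mem_singleton.1 hs]
    rw [hV, ← hg.integral_coalitionUtility_self, coinLaw,
      integral_prod _ (hg.integral_coalitionUtility _ {i} {i} _).1]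
    conv_rhs => rw [← hp.map_eq]
    rw [integral_map hp.measurable.aemeasurable
      hm.stronglyMeasurable.integral_prod_right'.aestronglyMeasurable]
    refine integral_congr_ae (.of_forall fun θ => integral_congr_ae (.of_forall fun ω => ?_))
    have : play g {i} (fun _ => V i) (θ, ω) = (fun _ => g (V i) (θ i), ω) := by
      simp only [play, Prod.mk.injEq, and_true]
      funext s
      rw [Finset.mem_singleton.1 s.2]
    simp only [this]
  have hD : ∀ i, M.expectedWelfare g D {i} = ∫ v, M.welfare g {i} (fun _ => v) ∂D := by
    intro i
    have hp := measurePreserving_eval_infinitePi (fun _ : ℕ => D) i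
    conv_rhs => rw [← hp.map_eq]
    have hm : Measurable fun v : ℝ≥0 => M.welfare g {i} fun _ => v :=
      (hg.measurable_welfare {i}).comp (measurable_pi_lambda _ fun _ => measurable_id)
    rw [integral_map hp.measurable.aemeasurable hm.aestronglyMeasurable]
    exact integral_congr_ae (.of_forall fun V => welfare_congr fun s hs => by
      rw [Finset.mem_singleton.1 hs])
  rw [hD, hD]
  refine integral_congr_ae (.of_forall fun v => ?_)
  simp only [hw, hh]

/-- The welfare grows linearly in the number of users, but a bounded number of users is confirmed and
the largest of `n` values of finite mean is `o(n)`. -/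
lemma Simulates.expectedWelfare_eq_zero (hg : M.Simulates g) (hmean : ∫⁻ v, (v : ℝ≥0∞) ∂D < ∞)
    {k : ℕ} (hM : M.BlockSizeAtMost k) (hsymm : M.IsWeaklySymmetric)
    (huic : M.BayesianUIC D) (hmic : M.BayesianMIC D) (hscp : M.BayesianSCP D 1)
    (hglobal : M.GlobalSCP) (U : Finset ℕ) : M.expectedWelfare g D U = 0 := by
  have hsum : ∀ U, M.expectedWelfare g D U = U.card * M.expectedWelfare g D {0} := fun U => by
    rw [hg.expectedWelfare_eq_sum hmean huic hmic hscp hglobal,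
      Finset.sum_congr rfl fun i _ => hg.expectedWelfare_singleton_eq hsymm i 0]
    simp
  have hle : M.expectedWelfare g D {0} ≤ 0 := by
    refine ge_of_tendsto' (tendsto_integral_excess hmean) fun K => ?_
    set a := M.expectedWelfare g D {0}
    set ε := ∫ v : ℝ≥0, ((v - K : ℝ≥0) : ℝ) ∂D
    by_contra hlt
    obtain ⟨n, hn⟩ := exists_nat_gt ((k : ℝ) * K / (a - ε))
    have h := hg.expectedWelfare_le hmean hM (Finset.range n) K
    rw [hsum, Finset.card_range] at h
    rw [div_lt_iff₀ (by linarith)] at hn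
    push_cast at h
    linarith
  rw [hsum, le_antisymm hle (hg.expectedWelfare_nonneg _), mul_zero]

lemma Simulates.expectedSocialWelfare_eq (hg : M.Simulates g) (hmean : ∫⁻ v, (v : ℝ≥0∞) ∂D < ∞)
    (U : Finset ℕ) : M.expectedSocialWelfare D U = ((M.expectedWelfare g D U : ℝ) : EReal) := by
  have hid := isIntegrableProfile_id hmean
  have hφ : Measurable fun p : ℝ≥0 × unitInterval => (p.1, g p.1 p.2) :=
    measurable_fst.prodMk hg.measurable
  have hpair : Measurable fun x : (ℕ → ℝ≥0) × ((ℕ → unitInterval) × Ω) =>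
      ((fun s : U => (x.1 s, g (x.1 s) (x.2.1 s)), x.2.2) : (U → ℝ≥0 × ℝ) × Ω) := by
    refine Measurable.prodMk (measurable_pi_lambda _ fun s => ?_) (by fun_prop)
    exact hφ.comp (f := fun x : (ℕ → ℝ≥0) × ((ℕ → unitInterval) × Ω) => (x.1 s, x.2.1 s))
      (by fun_prop)
  have hlaw : (Measure.pi fun _ : U => D ⊗ₘ M.bidding).prod P =
      ((valueLaw D).prod (coinLaw P)).map
        (fun x => (fun s : U => (x.1 s, g (x.1 s) (x.2.1 s)), x.2.2)) := by
    have hm : Measurable fun p : (ℕ → ℝ≥0) × (ℕ → unitInterval) =>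
        fun s : U => (p.1 s, g (p.1 s) (p.2 s)) :=
      measurable_pi_lambda _ fun s => hφ.comp
        (f := fun p : (ℕ → ℝ≥0) × (ℕ → unitInterval) => (p.1 s, p.2 s)) (by fun_prop)
    rw [valueLaw, coinLaw, ← Measure.prodAssoc_prod, Measure.map_map hpair (by fun_prop),
      hg.compProd_eq_map, ← map_pi_prod_infinitePi D (volume : Measure unitInterval) U
        (fun _ => hφ)]
    conv_lhs => rw [← Measure.map_id (μ := P)]
    rw [Measure.map_prod_map _ _ hm (by fun_prop)]
    rfl
  have hbids : Measurable fun z : (U → ℝ≥0 × ℝ) × Ω =>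
      ((fun t => (z.1 t).2, z.2) : (U → ℝ) × Ω) := by fun_prop
  rw [expectedSocialWelfare, hlaw, expectation_map hpair]
  · have he : ((fun z : (U → ℝ≥0 × ℝ) × Ω =>
        (∑ s : U, ((if M.confirmed U (fun t => (z.1 t).2) z.2 s = true then ((z.1 s).1 : ℝ) else 0) -
          M.payment U (fun t => (z.1 t).2) z.2 s)) + M.revenue U (fun t => (z.1 t).2) z.2) ∘
        fun x : (ℕ → ℝ≥0) × ((ℕ → unitInterval) × Ω) =>
          ((fun s : U => (x.1 s, g (x.1 s) (x.2.1 s)), x.2.2) : (U → ℝ≥0 × ℝ) × Ω)) =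
        fun x => M.coalitionUtility ∅ U x.1 U (play g U x.1 x.2) := by
      funext x
      simp [coalitionUtility, userUtility, play]
    rw [he]
    have hint : Integrable (fun x : (ℕ → ℝ≥0) × ((ℕ → unitInterval) × Ω) =>
        M.coalitionUtility ∅ U x.1 U (play g U x.1 x.2)) ((valueLaw D).prod (coinLaw P)) := by
      have : (fun x : (ℕ → ℝ≥0) × ((ℕ → unitInterval) × Ω) =>
          M.coalitionUtility ∅ U x.1 U (play g U x.1 x.2)) = fun x =>
          (∑ i ∈ U, ((x.1 i : ℝ) * M.confirmedAt U (play g U x.1 x.2) i -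
            M.paymentAt U (play g U x.1 x.2) i)) + M.revenueAt U (play g U x.1 x.2) := by
        funext x
        rw [coalitionUtility, userUtility_eq]
        simp only [Finset.notMem_empty, if_false]
        congr 1
        exact Finset.sum_congr rfl fun i hi => by simp [hi]
      rw [this]
      refine (integrable_finsetSum _ fun i _ => Integrable.sub ?_
        (hg.integrable_paymentAt_prod U i hid)).add (hg.integrable_revenueAt_prod U hid)
      refine integrable_prod_of_nonneg_of_le (Measurable.mul (by fun_prop)
        ((M.measurable_confirmedAt U i).comp (hg.measurable_play U)))
        (fun x => mul_nonneg (by positivity) (M.confirmedAt_nonneg U _ i))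
        (fun V => (hg.integrable_confirmedAt U i V).const_mul (V i : ℝ)) (hid.integrable i)
        fun V => ?_
      change ∫ p, (V i : ℝ) * M.confirmedAt U (play g U V p) i ∂coinLaw P ≤ V i
      rw [integral_const_mul]
      exact mul_le_of_le_one_right (by positivity) (hg.allocProb_le_one U i V)
    rw [expectation_eq_integral hint, integral_prod _ hint]
    simp only [hg.integral_coalitionUtility_self]
    rfl
  · refine Measurable.add (Finset.measurable_sum _ fun s _ => Measurable.sub
      (Measurable.ite ?_ (by fun_prop) measurable_const) ((M.measurable_payment U s).comp hbids))
      ((M.measurable_revenue U).comp hbids)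
    exact measurableSet_eq_fun ((M.measurable_confirmed U s).comp hbids) measurable_const

end Interim

end TFM

theorem mainTheorem6 {Ω : Type*} [MeasurableSpace Ω] (P : Measure Ω) [IsProbabilityMeasure P]
    (D : Measure ℝ≥0) [IsProbabilityMeasure D] (hmean : ∫⁻ v, (v : ℝ≥0∞) ∂D < ∞)
    (k : ℕ) (hk : 1 ≤ k) (M : TFM P) (hblock : M.BlockSizeAtMost k) (hsymm : M.IsWeaklySymmetric)
    (huic : M.BayesianUIC D) (hmic : M.BayesianMIC D) (hscp : M.BayesianSCP D 1)
    (hglobal : M.GlobalSCP) (U : Finset ℕ) :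
    M.expectedSocialWelfare D U = 0 := by
  obtain ⟨g, hg⟩ := M.exists_simulates
  rw [hg.expectedSocialWelfare_eq hmean,
    hg.expectedWelfare_eq_zero hmean hblock hsymm huic hmic hscp hglobal]
  rfl
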